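/- **Theorem 0.2.** Let $h_0\ge 1$ be an integer, let $(r_n)_{n\ge 0}$ be a sequence of integers with $r_n\ge 2$ and $r_n\to\infty$, and let $(z_n)_{n\ge 0}$ be a sequence of non-negative integers. For $n\ge 0$ put $$h_{n+1}=r_n(h_n+z_n)+\frac{r_n(r_n-1)}2,\qquad F_n=\{0,1,\dots,h_n-1\},$$ $$c_{n+1}(0)=0,\qquad c_{n+1}(i+1)=c_{n+1}(i)+h_n+z_n+i,\qquad C_{n+1}=\{c_{n+1}(i)\mid 0\le i<r_n\}.$$ Let $X=\bigcup_{n\ge 0}X_n$ be the inductive limit of the spaces $X_n=F_n\times C_{n+1}\times C_{n+2}\times\cdots$ under the embeddings $X_n\to X_{n+1}$, $(f,c_{n+1},c_{n+2},\dots)\mapsto(f+c_{n+1},c_{n+2},\dots)$, with its Borel $\sigma$-algebra. Let $\mu$ be the measure on $X$ whose restriction to each $X_n$ is $(r_0r_1\cdots r_{n-1})^{-1}$ times the product of the counting measure on $F_n$ and the uniform probability measures on $C_{n+1},C_{n+2},\dots$. Let $T$ be the associated high staircase transformation of $(X,\mu)$, that is, $T(f,c_{n+1},c_{n+2},\dots)=(f+1,c_{n+1},c_{n+2},\dots)$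 whenever $(f,c_{n+1},c_{n+2},\dots)\in X_n$ and $f+1\in F_n$, for $n\ge 0$. Suppose that $\mu(X)=\infty$ and that the restricted growth condition $$\lim_{n\to\infty}\frac{r_n^2}{r_0r_1\cdots r_{n-1}}=0$$ holds. Then $T$ is a mixing transformation of $(X,\mu)$: it preserves $\mu$, and $\mu(T^nA\cap B)\to 0$ as $n\to\infty$ for all measurable sets $A,B\subset X$ of finite measure. -/

import Mathlib

open MeasureTheory Filter Topology
open scoped ENNReal

noncomputable section

/-- The data of a `(C, F)`-construction for `ℤ`: heights `h n` of the towers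
`F n = {0, 1, …, h n - 1}`, and finite sets `C n ⊆ ℤ` describing the positions at which the copies
of `F n` are placed inside `F (n + 1)`.

The index of `C` is shifted by one with respect to the common convention: `C n` here is the set
that is often written `C_{n+1}`.  No condition on the total measure is imposed: the invariant
measure may be finite or infinite. -/
structure CFData where
  h : ℕ → ℕ
  C : ℕ → Finset ℤ
  h_zero_pos : 0 < h 0
  one_lt_card : ∀ n, 1 < (C n).card
  zero_mem : ∀ n, 0 ∈ C n
  add_mem : ∀ n, ∀ f ∈ Finset.Ico (0 : ℤ) (h n), ∀ c ∈ C n,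
    f + c ∈ Finset.Ico (0 : ℤ) (h (n + 1))
  disjoint_translates : ∀ n, ∀ c ∈ C n, ∀ c' ∈ C n, c ≠ c' →
    ∀ f ∈ Finset.Ico (0 : ℤ) (h n), ∀ f' ∈ Finset.Ico (0 : ℤ) (h n), f + c ≠ f' + c'

namespace CFData

variable (D : CFData)

/-- `F n = {0, 1, …, h n - 1}`, as a set of integers. -/
def F (n : ℕ) : Finset ℤ := Finset.Ico (0 : ℤ) (D.h n)

/-- The space `X_n = F n × C n × C (n + 1) × ⋯`, with the product σ-algebra
(all factors are finite and discrete). -/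
abbrev Tower (n : ℕ) : Type := ↥(D.F n) × ((k : Set.Ici n) → ↥(D.C k))

/-- The position inside `F m` (for `n ≤ m`) of a point `(f, c n, c (n + 1), …)` of `X_n`, when
`X_n` is embedded into `X_m` by iterating
`(f, c n, c (n + 1), …) ↦ (f + c n, c (n + 1), …)`. -/
def pos {n : ℕ} (p : D.Tower n) (m : ℕ) : ℤ :=
  (p.1 : ℤ) + ∑ k ∈ Finset.Ico n m, if hk : n ≤ k then (p.2 ⟨k, hk⟩ : ℤ) else 0

/-- Two points of the disjoint union of the `X_n` are identified if they have the same image in some `X_N`. -/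
def Same (a b : Σ n, D.Tower n) : Prop :=
  ∃ (N : ℕ) (ha : a.1 ≤ N) (hb : b.1 ≤ N), D.pos a.2 N = D.pos b.2 N ∧
    ∀ (k : ℕ) (hk : N ≤ k),
      (a.2.2 ⟨k, le_trans ha hk⟩ : ℤ) = (b.2.2 ⟨k, le_trans hb hk⟩ : ℤ)

theorem pos_of_le {n : ℕ} (p : D.Tower n) {N M : ℕ} (hN : n ≤ N) (hM : N ≤ M) :
    D.pos p M = D.pos p N + ∑ k ∈ Finset.Ico N M, if hk : n ≤ k then (p.2 ⟨k, hk⟩ : ℤ) else 0 := by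
  unfold pos
  rw [← Finset.sum_Ico_consecutive _ hN hM, add_assoc]

theorem Same.mono {a b : Σ n, D.Tower n} {N M : ℕ} (ha : a.1 ≤ N) (hb : b.1 ≤ N)
    (h : D.pos a.2 N = D.pos b.2 N)
    (ht : ∀ (k : ℕ) (hk : N ≤ k),
      (a.2.2 ⟨k, le_trans ha hk⟩ : ℤ) = (b.2.2 ⟨k, le_trans hb hk⟩ : ℤ)) (hM : N ≤ M) :
    D.pos a.2 M = D.pos b.2 M := by
  rw [D.pos_of_le a.2 ha hM, D.pos_of_le b.2 hb hM, h]
  congr 1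
  refine Finset.sum_congr rfl fun k hk => ?_
  have hk' := (Finset.mem_Ico.1 hk).1
  rw [dif_pos (ha.trans hk'), dif_pos (hb.trans hk'), ht k hk']

/-- The identification of the towers, as an equivalence relation. -/
def towerSetoid : Setoid (Σ n, D.Tower n) where
  r := D.Same
  iseqv :=
    { refl := fun a => ⟨a.1, le_rfl, le_rfl, rfl, fun _ _ => rfl⟩
      symm := fun ⟨N, ha, hb, h, ht⟩ => ⟨N, hb, ha, h.symm, fun k hk => (ht k hk).symm⟩
      trans := fun ⟨N, ha, hb, h, ht⟩ ⟨M, hb', hc, h', ht'⟩ =>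
        ⟨max N M, ha.trans (le_max_left _ _), hc.trans (le_max_right _ _),
          (Same.mono D ha hb h ht (le_max_left _ _)).trans
            (Same.mono D hb' hc h' ht' (le_max_right _ _)),
          fun k hk => (ht k ((le_max_left _ _).trans hk)).trans
            (ht' k ((le_max_right _ _).trans hk))⟩ }

/-- The space `X = ⋃ X_n` of the `(C, F)`-construction: the inductive limit of the `X_n`. -/
def Space : Type := Quotient D.towerSetoid

/-- The canonical map `X_n → X`. -/
def toSpace (n : ℕ) (p : D.Tower n) : D.Space := Quotient.mk D.towerSetoid ⟨n, p⟩

/-- The σ-algebra of `X`: a set is measurable iff its trace on every `X_n` is.  This is the Borel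
σ-algebra of the inductive limit topology, as the `X_n` are open in `X`. -/
instance : MeasurableSpace D.Space :=
  ⨅ n, MeasurableSpace.map (D.toSpace n) inferInstance

/-- The invariant measure on `X_n = F n × C n × C (n + 1) × ⋯`: the product of the counting measure
on `F n` and the uniform probability measures on the `C k`, divided by `#C 0 ⋯ #C (n - 1)`. -/
def towerMeasure (n : ℕ) : Measure (D.Tower n) :=
  (∏ k ∈ Finset.range n, ((D.C k).card : ℝ≥0∞))⁻¹ •
    (Measure.count : Measure ↥(D.F n)).prod
      (Measure.infinitePi fun k : Set.Ici n =>
        (ProbabilityTheory.uniformOn Set.univ : Measure ↥(D.C k)))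

/-- The part of `X_n` that is not already contained in an earlier tower. -/
def fresh (n : ℕ) : Set (D.Tower n) := {p | ∀ m < n, D.toSpace n p ∉ Set.range (D.toSpace m)}

/-- The invariant measure on `X`, normalized so that `X_0` has measure `h 0`: it is glued from the
measures on `X_n \ (X_0 ∪ ⋯ ∪ X_{n-1})`, `n ≥ 0`. -/
def measure : Measure D.Space :=
  Measure.sum fun n => ((D.towerMeasure n).restrict (D.fresh n)).map (D.toSpace n)

open scoped Classical in
/-- The `(C, F)`-transformation: `T (f, c n, c (n + 1), …) = (f + 1, c n, c (n + 1), …)` for every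
representation of the point in a tower `X_n` with `f + 1 ∈ F n`.  It does not matter which one is
used, see `transformation_toSpace`.  The points without such a representation, at most countably many,
are left fixed. -/
def transformation (x : D.Space) : D.Space :=
  if hx : ∃ q : Σ n, D.Tower n, D.toSpace q.1 q.2 = x ∧ (q.2.1 : ℤ) + 1 ∈ D.F q.1 then
    D.toSpace hx.choose.1 (⟨(hx.choose.2.1 : ℤ) + 1, hx.choose_spec.2⟩, hx.choose.2.2)
  else x

theorem transformation_toSpace {n : ℕ} (p : D.Tower n) (hp : (p.1 : ℤ) + 1 ∈ D.F n) :
    D.transformation (D.toSpace n p) = D.toSpace n (⟨(p.1 : ℤ) + 1, hp⟩, p.2) := by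
  have hx : ∃ q : Σ m, D.Tower m, D.toSpace q.1 q.2 = D.toSpace n p ∧ (q.2.1 : ℤ) + 1 ∈ D.F q.1 :=
    ⟨⟨n, p⟩, rfl, hp⟩
  rw [transformation, dif_pos hx]
  obtain ⟨N, ha, hb, h, ht⟩ : D.Same hx.choose ⟨n, p⟩ := Quotient.exact hx.choose_spec.1
  refine Quotient.sound (s := D.towerSetoid) ⟨N, ha, hb, ?_, ht⟩
  unfold pos at h ⊢
  dsimp only at h ⊢
  linarith

end CFData

/-- A transformation `T` of a measure space is mixing (of zero type), in the sense of infinite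
measure preserving transformations: it preserves the measure, and `μ (Tⁿ A ∩ B) → 0` for all sets
`A`, `B` of finite measure. -/
structure IsInfiniteMixing {X : Type*} [MeasurableSpace X] (T : X → X) (μ : Measure X) : Prop where
  measurePreserving : MeasurePreserving T μ μ
  tendsto_zero : ∀ A B : Set X, MeasurableSet A → MeasurableSet B → μ A < ∞ → μ B < ∞ →
    Tendsto (fun n : ℕ => μ (T^[n] '' A ∩ B)) atTop (𝓝 0)

namespace HighStaircase

/-- The heights `h n` of a high staircase:
`h (n + 1) = r n * (h n + z n) + r n * (r n - 1) / 2`. -/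
def height (h₀ : ℕ) (r z : ℕ → ℕ) : ℕ → ℕ
  | 0 => h₀
  | n + 1 => r n * (height h₀ r z n + z n) + r n * (r n - 1) / 2

/-- The position of the bottom of the `i`-th copy of the `n`-th tower inside the next tower:
the `i`-th copy is followed by `z n + i` spacers. -/
def cut (h₀ : ℕ) (r z : ℕ → ℕ) (n : ℕ) : ℕ → ℕ
  | 0 => 0
  | i + 1 => cut h₀ r z n i + height h₀ r z n + z n + i

theorem height_pos {h₀ : ℕ} {r z : ℕ → ℕ} (hh : 0 < h₀) (hr : ∀ n, 2 ≤ r n) (n : ℕ) :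
    0 < height h₀ r z n := by
  induction n with
  | zero => exact hh
  | succ n ih =>
    have := hr n
    have : 0 < r n * (height h₀ r z n + z n) := by positivity
    simp only [height]
    omega

theorem cut_eq (h₀ : ℕ) (r z : ℕ → ℕ) (n i : ℕ) :
    cut h₀ r z n i = i * (height h₀ r z n + z n) + i * (i - 1) / 2 := by
  rw [← Finset.sum_range_id]
  induction i with
  | zero => simp [cut]
  | succ i ih =>
    rw [cut, ih, Finset.sum_range_succ]
    ring

theorem cut_add_height_le (h₀ : ℕ) (r z : ℕ → ℕ) (n : ℕ) {i j : ℕ} (hij : i < j) :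
    cut h₀ r z n i + height h₀ r z n ≤ cut h₀ r z n j := by
  induction j, hij using Nat.le_induction with
  | base => simp only [cut]; omega
  | succ j _ ih => simp only [cut]; omega

/-- The `(C, F)`-data of the high staircase with initial height `h₀`, cuts `r` and spacer layers
`z`. -/
def data (h₀ : ℕ) (r z : ℕ → ℕ) (hh : 0 < h₀) (hr : ∀ n, 2 ≤ r n) : CFData where
  h := height h₀ r z
  C n := (Finset.range (r n)).image fun i => (cut h₀ r z n i : ℤ)
  h_zero_pos := hh
  one_lt_card n := by
    rw [Finset.card_image_of_injOn, Finset.card_range]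
    · exact hr n
    · intro i _ j _ hij
      have hij' : cut h₀ r z n i = cut h₀ r z n j := by simpa using hij
      have hp := height_pos (z := z) hh hr n
      rcases lt_trichotomy i j with h | h | h
      · have := cut_add_height_le h₀ r z n h
        omega
      · exact h
      · have := cut_add_height_le h₀ r z n h
        omega
  zero_mem n := by
    refine Finset.mem_image.2 ⟨0, Finset.mem_range.2 ?_, rfl⟩
    have := hr n
    omega
  add_mem n f hf c hc := by
    obtain ⟨i, hi, rfl⟩ := Finset.mem_image.1 hc
    have h1 := cut_add_height_le h₀ r z n (Finset.mem_range.1 hi)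
    have h2 : cut h₀ r z n (r n) = height h₀ r z (n + 1) := by rw [cut_eq, height]
    rw [Finset.mem_Ico] at hf ⊢
    omega
  disjoint_translates n c hc c' hc' hne f hf f' hf' := by
    obtain ⟨i, -, rfl⟩ := Finset.mem_image.1 hc
    obtain ⟨j, -, rfl⟩ := Finset.mem_image.1 hc'
    rw [Finset.mem_Ico] at hf hf'
    rcases lt_trichotomy i j with h | h | h
    · have := cut_add_height_le h₀ r z n h
      omega
    · exact absurd (by rw [h]) hne
    · have := cut_add_height_le h₀ r z n h
      omega

/-- The restricted growth condition on the sequence of cuts. -/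
def RestrictedGrowth (r : ℕ → ℕ) : Prop :=
  Tendsto (fun n => (r n : ℝ) ^ 2 / ∏ i ∈ Finset.range n, (r i : ℝ)) atTop (𝓝 0)

end HighStaircase

end

/-!
The transformation preserves the measure because on the `n`-th tower it agrees, outside of the top
level, with a cyclic permutation of the levels, and the measure of a level tends to zero.

Mixing is reduced to a statement on finite sets of integers.  Sets of finite measure are, up to
small measure, contained in some `X_l`, so it suffices that `μ (Tᵏ X_l ∩ X_l) → 0`.  If `E n` is
the set of positions of `X_l` inside the `n`-th tower, this measure is, up to a constant factor, the
supremum over `n` of the correlations `a_n(k) = #{x ∈ E n | x + k ∈ E n} / #E n`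
(`CFData.isInfiniteMixing_of_autocorr`), which has to be small for large `k`
(`StaircasePositions.exists_corr_le`).  Write `w n = h n + z n`.

* Infinite measure means `#E n / h n → 0`.  Intervals of length `h n` meet at most two copies of the
  `n`-th tower, hence the correlations are small on average over long intervals, and over long
  progressions of bounded step (`exists_sum_corr_progression_le`).
* As `E (n + 1)` consists of `r n` copies of `E n` at positions `i * w n + i * (i - 1) / 2`, the
  correlation at `k ≥ h n` in tower `n + 1` is bounded by three averages of correlations along
  progressions of length `r n` whose step `d < r n` is the distance of the indices of two copies
  (`corr_succ_le_three_mul`); here `r n ^ 2` has to be small compared to `h n`.  Towers above `n + 1`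
  hardly contribute if `k < h (n + 1)` (`exists_corr_le_corr_add`).
* For `h p ≤ k ≤ K * w p` with `K` fixed, only bounded steps occur, and so the correlations are small
  there (`exists_corr_le_of_le_mul`).
* For an arbitrary step `d < r n`, choose `q` of smaller order than `r n` such that the first
  multiples of `q * d` lie in a range `h p ≤ k ≤ K * w p`.  By the Cauchy–Schwarz inequality, the
  averages along progressions of step `q * d`, and hence those of step `d`, are small
  (`sum_autocorr_le_of_multiples`, `exists_sum_corr_le_of_lt_r`).  It is the condition
  `r p ^ 2 ≤ h p ≤ d < r n` that leaves room for such a `q`.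
-/

noncomputable section

/-! ### Autocorrelation of finite sets of integers -/

/-- The proportion of the points `x` of `S` for which `x + k` is again in `S`. -/
def autocorr (S : Finset ℤ) (k : ℤ) : ℝ :=
  (∑ x ∈ S, if x + k ∈ S then (1 : ℝ) else 0) / S.card

theorem autocorr_nonneg (S : Finset ℤ) (k : ℤ) : 0 ≤ autocorr S k := by
  unfold autocorr
  positivity

theorem autocorr_eq_card (S : Finset ℤ) (k : ℤ) :
    autocorr S k = ((S.filter fun x => x + k ∈ S).card : ℝ) / S.card := by
  simp [autocorr]

theorem autocorr_le_one (S : Finset ℤ) (k : ℤ) : autocorr S k ≤ 1 := by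
  rw [autocorr_eq_card]
  refine div_le_one_of_le₀ ?_ (by positivity)
  exact_mod_cast Finset.card_filter_le _ _

theorem autocorr_neg (S : Finset ℤ) (k : ℤ) : autocorr S (-k) = autocorr S k := by
  rw [autocorr_eq_card, autocorr_eq_card]
  congr 2
  refine Finset.card_bij' (fun x _ => x + -k) (fun x _ => x + k) ?_ ?_ ?_ ?_ <;>
    simp +contextual

theorem autocorr_eq_zero {S : Finset ℤ} {h : ℕ} (hS : S ⊆ Finset.Ico 0 (h : ℤ)) {k : ℤ}
    (hk : (h : ℤ) ≤ |k|) : autocorr S k = 0 := by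
  rw [autocorr_eq_card]
  have : (S.filter fun x => x + k ∈ S) = ∅ := by
    refine Finset.filter_eq_empty_iff.2 fun x hx hxk => ?_
    have h1 := Finset.mem_Ico.1 (hS hx)
    have h2 := Finset.mem_Ico.1 (hS hxk)
    rcases abs_cases k with h | h <;> omega
  simp [this]

/-- Autocorrelations sum along an arithmetic progression to at most the norm of the corresponding
sum of translates of the indicator function: this is the Cauchy–Schwarz inequality. -/
theorem sq_sum_autocorr_le (S : Finset ℤ) (k d : ℤ) (L : ℕ) :
    (∑ j ∈ Finset.range L, autocorr S (k - j * d)) ^ 2 ≤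
      ∑ i ∈ Finset.range L, ∑ j ∈ Finset.range L, autocorr S ((i - j) * d) := by
  rcases S.eq_empty_or_nonempty with rfl | hS
  · simp [autocorr]
  have hc : (0 : ℝ) < S.card := by exact_mod_cast hS.card_pos
  have key : ∀ u v : ℤ, (∑ x ∈ S, (if x + u ∈ S then (1 : ℝ) else 0) *
      (if x + v ∈ S then (1 : ℝ) else 0)) ≤ S.card * autocorr S (v - u) := by
    intro u v
    rw [autocorr_eq_card, mul_div_cancel₀ _ hc.ne']
    have : ∀ x, (if x + u ∈ S then (1 : ℝ) else 0) * (if x + v ∈ S then (1 : ℝ) else 0) =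
        if x + u ∈ S ∧ x + v ∈ S then (1 : ℝ) else 0 := by
      intro x
      by_cases h1 : x + u ∈ S <;> by_cases h2 : x + v ∈ S <;> simp [h1, h2]
    simp_rw [this]
    rw [Finset.sum_boole]
    norm_cast
    refine Finset.card_le_card_of_injOn (fun x => x + u) ?_ fun x _ y _ hxy => by simpa using hxy
    intro x hx
    have hx := (Finset.mem_filter.1 hx).2
    refine Finset.mem_coe.2 (Finset.mem_filter.2 ⟨hx.1, ?_⟩)
    have : x + u + (v - u) = x + v := by ring
    rw [this]
    exact hx.2
  have h1 : S.card * ∑ j ∈ Finset.range L, autocorr S (k - j * d) =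
      ∑ x ∈ S, ∑ j ∈ Finset.range L, if x + (k - j * d) ∈ S then (1 : ℝ) else 0 := by
    rw [Finset.sum_comm, Finset.mul_sum]
    refine Finset.sum_congr rfl fun j _ => ?_
    rw [autocorr, mul_div_cancel₀ _ hc.ne']
  have h2 := sq_sum_le_card_mul_sum_sq (s := S)
    (f := fun x => ∑ j ∈ Finset.range L, if x + (k - j * d) ∈ S then (1 : ℝ) else 0)
  rw [← h1] at h2
  have h3 : ∑ x ∈ S, (∑ j ∈ Finset.range L, if x + (k - j * d) ∈ S then (1 : ℝ) else 0) ^ 2 ≤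
      S.card * ∑ i ∈ Finset.range L, ∑ j ∈ Finset.range L, autocorr S ((i - j) * d) := by
    simp_rw [sq, Finset.sum_mul_sum]
    rw [Finset.sum_comm, Finset.mul_sum]
    refine Finset.sum_le_sum fun i _ => ?_
    rw [Finset.sum_comm, Finset.mul_sum]
    refine Finset.sum_le_sum fun j _ => (key _ _).trans_eq ?_
    congr 2
    ring
  have h4 := h2.trans (mul_le_mul_of_nonneg_left h3 hc.le)
  rw [mul_pow, ← mul_assoc, ← sq] at h4
  exact le_of_mul_le_mul_left h4 (by positivity)

theorem sum_range_le_sum_range_shift {g : ℕ → ℝ} (h0 : ∀ j, 0 ≤ g j) (h1 : ∀ j, g j ≤ 1)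
    (L s : ℕ) : ∑ j ∈ Finset.range L, g j ≤ ∑ j ∈ Finset.range L, g (j + s) + s := by
  have h2 : ∑ j ∈ Finset.range L, g j ≤ ∑ j ∈ Finset.range (s + L), g j :=
    Finset.sum_le_sum_of_subset_of_nonneg (Finset.range_mono (by omega)) fun j _ _ => h0 j
  rw [Finset.sum_range_add] at h2
  have h3 : ∑ j ∈ Finset.range s, g j ≤ s := by
    simpa using Finset.sum_le_card_nsmul (Finset.range s) g 1 fun j _ => h1 j
  simp_rw [add_comm s] at h2
  linarith

/-- If the correlations at the first `M` multiples of `q * d` are at most `ε`, then the averages of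
the correlations along progressions with step `d` are small.  Indeed the progression is, up to
boundary terms, a union of progressions with step `q * d` and length `M`, to which the
Cauchy–Schwarz inequality applies. -/
theorem sum_autocorr_le_of_multiples (S : Finset ℤ) {M q d : ℕ} {ε δ : ℝ} (hM : 0 < M)
    (hδ : 0 ≤ δ) (hMδ : M + M ^ 2 * ε ≤ (M * δ) ^ 2)
    (hε : ∀ i : ℕ, 1 ≤ i → i < M → autocorr S ((i * (q * d) : ℕ) : ℤ) ≤ ε)
    (hε0 : 0 ≤ ε) (k : ℤ) (L : ℕ) :
    ∑ j ∈ Finset.range L, autocorr S (k - j * d) ≤ L * δ + M * q := by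
  have hM' : (0 : ℝ) < M := by exact_mod_cast hM
  have block : ∀ k' : ℤ, ∑ i ∈ Finset.range M, autocorr S (k' - i * (q * d : ℕ)) ≤ M * δ := by
    intro k'
    refine abs_le_of_sq_le_sq' ?_ (by positivity) |>.2
    refine (sq_sum_autocorr_le S k' _ M).trans (le_trans ?_ hMδ)
    have : ∀ i ∈ Finset.range M, ∀ j ∈ Finset.range M,
        autocorr S (((i : ℤ) - j) * (q * d : ℕ)) ≤ (if i = j then 1 else 0) + ε := by
      intro i hi j hj
      have hi := Finset.mem_range.1 hi
      have hj := Finset.mem_range.1 hj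
      split_ifs with hij
      · linarith [autocorr_le_one S (((i : ℤ) - j) * (q * d : ℕ))]
      · rcases lt_or_gt_of_ne hij with h | h
        · have h2 := hε (j - i) (by omega) (by omega)
          rw [← autocorr_neg, zero_add]
          convert h2 using 2
          push_cast [Nat.cast_sub h.le]
          ring
        · have h2 := hε (i - j) (by omega) (by omega)
          rw [zero_add]
          convert h2 using 2
          push_cast [Nat.cast_sub h.le]
          ring
    refine (Finset.sum_le_sum fun i hi => Finset.sum_le_sum (this i hi)).trans ?_
    have e : ∀ i ∈ Finset.range M, ∑ j ∈ Finset.range M, ((if i = j then (1 : ℝ) else 0) + ε) =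
        1 + M * ε := by
      intro i hi
      rw [Finset.sum_add_distrib, Finset.sum_ite_eq, if_pos hi]
      simp
    rw [Finset.sum_congr rfl e]
    simp only [Finset.sum_const, Finset.card_range, nsmul_eq_mul]
    apply le_of_eq
    ring
  have shift : ∀ i ∈ Finset.range M, ∑ j ∈ Finset.range L, autocorr S (k - j * d) ≤
      ∑ j ∈ Finset.range L, autocorr S (k - j * d - i * (q * d : ℕ)) + M * q := by
    intro i hi
    refine (sum_range_le_sum_range_shift (g := fun j : ℕ => autocorr S (k - j * d))
      (fun _ => autocorr_nonneg _ _) (fun _ => autocorr_le_one _ _) L (i * q)).trans ?_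
    have : ((i * q : ℕ) : ℝ) ≤ M * q := by
      exact_mod_cast Nat.mul_le_mul_right q (Finset.mem_range.1 hi).le
    refine add_le_add (le_of_eq ?_) this
    refine Finset.sum_congr rfl fun j _ => ?_
    congr 1
    push_cast
    ring
  have h1 := Finset.sum_le_sum shift
  rw [Finset.sum_const, Finset.sum_add_distrib, Finset.sum_comm] at h1
  simp only [Finset.sum_const, Finset.card_range, nsmul_eq_mul] at h1
  have h2 := Finset.sum_le_sum fun (j : ℕ) (_ : j ∈ Finset.range L) => block (k - j * d)
  simp only [Finset.sum_const, Finset.card_range, nsmul_eq_mul] at h2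
  have h3 : (M : ℝ) * ∑ j ∈ Finset.range L, autocorr S (k - j * d) ≤ M * (L * δ + M * q) := by
    nlinarith
  exact le_of_mul_le_mul_left h3 hM'

/-- Correlations sum over an interval to at most the largest number of points in a translate of
this interval. -/
theorem sum_autocorr_Ico_le {S : Finset ℤ} {N : ℕ} {B : ℝ} (hB0 : 0 ≤ B)
    (hB : ∀ v : ℤ, ((S.filter fun y => v ≤ y ∧ y < v + N).card : ℝ) ≤ B) (u : ℤ) :
    ∑ t ∈ Finset.Ico u (u + N), autocorr S t ≤ B := by
  rcases S.eq_empty_or_nonempty with rfl | hS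
  · simpa [autocorr] using hB0
  have hc : (0 : ℝ) < S.card := by exact_mod_cast hS.card_pos
  simp_rw [autocorr]
  rw [← Finset.sum_div, div_le_iff₀ hc, Finset.sum_comm]
  have : ∀ x ∈ S, ∑ t ∈ Finset.Ico u (u + N), (if x + t ∈ S then (1 : ℝ) else 0) ≤ B := by
    intro x _
    rw [Finset.sum_boole]
    refine le_trans ?_ (hB (x + u))
    norm_cast
    refine Finset.card_le_card_of_injOn (fun t => x + t) ?_ fun a _ b _ hab => by simpa using hab
    intro t ht
    have ht := Finset.mem_filter.1 ht
    have h1 := Finset.mem_Ico.1 ht.1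
    refine Finset.mem_coe.2 (Finset.mem_filter.2 ⟨ht.2, ?_⟩)
    push_cast
    constructor <;> omega
  refine (Finset.sum_le_sum this).trans_eq ?_
  simp [mul_comm]

/-- The sum of the correlations along a progression is bounded by the sum over the interval which
it spans. -/
theorem sum_autocorr_progression_le {S : Finset ℤ} {d L : ℕ} (hd : 0 < d) (k : ℤ) :
    ∑ j ∈ Finset.range L, autocorr S (k - j * d) ≤
      ∑ t ∈ Finset.Ico (k + 1 - (d * L : ℕ)) (k + 1 - (d * L : ℕ) + (d * L : ℕ)),
        autocorr S t := by
  have hd' : (0 : ℤ) < d := by exact_mod_cast hd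
  rw [← Finset.sum_image (s := Finset.range L) (g := fun j : ℕ => k - j * d)
    (f := fun t => autocorr S t)]
  · refine Finset.sum_le_sum_of_subset_of_nonneg ?_ fun _ _ _ => autocorr_nonneg _ _
    intro t ht
    obtain ⟨j, hj, rfl⟩ := Finset.mem_image.1 ht
    have hj := Finset.mem_range.1 hj
    have h1 : (j : ℤ) * d + d ≤ d * L := by
      have : ((j : ℤ) + 1) * d ≤ L * d := by gcongr; omega
      linarith
    have h2 : (0 : ℤ) ≤ j * d := by positivity
    rw [Finset.mem_Ico]
    push_cast
    constructor <;> linarith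
  · intro i _ j _ hij
    have hij : (k : ℤ) - i * d = k - j * d := hij
    have : (i : ℤ) * d = j * d := by linarith
    exact_mod_cast mul_right_cancel₀ hd'.ne' this

theorem sum_le_sum_of_support {ι : Type*} {s t : Finset ι} {f : ι → ℝ} (hf : ∀ i, 0 ≤ f i)
    (h : ∀ i ∈ s, f i ≠ 0 → i ∈ t) : ∑ i ∈ s, f i ≤ ∑ i ∈ t, f i := by
  classical
  rw [← Finset.sum_filter_ne_zero]
  refine Finset.sum_le_sum_of_subset_of_nonneg (fun i hi => ?_) fun i _ _ => hf i
  exact h i (Finset.mem_filter.1 hi).1 (Finset.mem_filter.1 hi).2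

/-! ### Correlations in the towers of a high staircase -/

/-- The triangular number `0 + 1 + ⋯ + (i - 1)`. -/
def triangle (i : ℕ) : ℕ := i * (i - 1) / 2

theorem triangle_succ (i : ℕ) : triangle (i + 1) = triangle i + i := Nat.triangle_succ i

theorem triangle_add (i d : ℕ) : triangle (i + d) = triangle i + triangle d + i * d := by
  induction d with
  | zero => simp [triangle]
  | succ d ih =>
    rw [← add_assoc, triangle_succ, triangle_succ, ih]
    ring

theorem triangle_le (i : ℕ) : triangle i ≤ i ^ 2 := by
  unfold triangle
  refine (Nat.div_le_self _ _).trans ?_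
  rw [sq]
  exact Nat.mul_le_mul_left _ (Nat.sub_le _ _)

/-- The position of the `i`-th copy of a tower inside the next tower of a staircase, where `w` is
the distance of the first two copies: the distance of the copies `i` and `i + 1` is `w + i`. -/
def stairPos (w i : ℕ) : ℤ := i * w + triangle i

theorem stairPos_add (w i d : ℕ) :
    stairPos w (i + d) = stairPos w i + d * w + triangle d + i * d := by
  simp only [stairPos, triangle_add]
  push_cast
  ring

theorem stairPos_nonneg (w i : ℕ) : 0 ≤ stairPos w i := by unfold stairPos; positivity

theorem stairPos_add_le {w i j : ℕ} (hij : i < j) : stairPos w i + w ≤ stairPos w j := by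
  obtain ⟨d, rfl⟩ := Nat.exists_eq_add_of_lt hij
  rw [add_assoc, stairPos_add]
  have : (0 : ℤ) ≤ d * w := by positivity
  have : (0 : ℤ) ≤ triangle (d + 1) := by positivity
  have : (0 : ℤ) ≤ (i : ℤ) * ((d + 1 : ℕ) : ℤ) := by positivity
  push_cast at *
  linarith

theorem stairPos_add_two_mul_le {w i j : ℕ} (hij : i + 2 ≤ j) :
    stairPos w i + 2 * w ≤ stairPos w j := by
  have h1 := stairPos_add_le (w := w) (show i < i + 1 by omega)
  have h2 := stairPos_add_le (w := w) (show i + 1 < j by omega)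
  linarith

/-- The positions `E n` of the points of a set inside the towers `{0, …, h n - 1}` of a high
staircase with cuts `r n` and spacer layers `z n`.  The construction may start with any tower, and
with any nonempty set `E 0` of its levels; then `E (n + 1)` consists of `r n` translates of
`E n`. -/
structure StaircasePositions where
  h : ℕ → ℕ
  r : ℕ → ℕ
  z : ℕ → ℕ
  E : ℕ → Finset ℤ
  two_le_r : ∀ n, 2 ≤ r n
  h_succ : ∀ n, h (n + 1) = r n * (h n + z n) + triangle (r n)
  nonempty : ∀ n, (E n).Nonempty
  subset_Ico : ∀ n, E n ⊆ Finset.Ico 0 (h n : ℤ)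
  E_succ : ∀ n, E (n + 1) =
    Finset.image₂ (fun e i => e + stairPos (h n + z n) i) (E n) (Finset.range (r n))

namespace StaircasePositions

variable (P : StaircasePositions)

/-- The distance of the first two copies of the `n`-th tower in the next one. -/
def w (n : ℕ) : ℕ := P.h n + P.z n

/-- The correlation at `k` of the positions in the `n`-th tower. -/
def corr (n : ℕ) (k : ℤ) : ℝ := autocorr (P.E n) k

theorem h_le_w (n : ℕ) : P.h n ≤ P.w n := Nat.le_add_right _ _

theorem mem_bounds {n : ℕ} {e : ℤ} (he : e ∈ P.E n) : 0 ≤ e ∧ e < P.h n :=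
  Finset.mem_Ico.1 (P.subset_Ico n he)

theorem h_pos (n : ℕ) : 0 < P.h n := by
  obtain ⟨e, he⟩ := P.nonempty n
  have := P.mem_bounds he
  omega

theorem w_pos (n : ℕ) : 0 < P.w n := (P.h_pos n).trans_le (P.h_le_w n)

theorem h_succ_eq (n : ℕ) : (P.h (n + 1) : ℤ) = stairPos (P.w n) (P.r n) := by
  rw [P.h_succ, stairPos, w]
  push_cast
  ring

theorem mul_w_le (n : ℕ) : P.r n * P.w n ≤ P.h (n + 1) := by
  rw [P.h_succ]; exact Nat.le_add_right _ _

theorem two_mul_h_le (n : ℕ) : 2 * P.h n ≤ P.h (n + 1) :=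
  (Nat.mul_le_mul (P.two_le_r n) (P.h_le_w n)).trans (P.mul_w_le n)

theorem h_lt_succ (n : ℕ) : P.h n < P.h (n + 1) := by
  have := P.two_mul_h_le n
  have := P.h_pos n
  omega

theorem h_strictMono : StrictMono P.h := strictMono_nat_of_lt_succ P.h_lt_succ

theorem card_pos (n : ℕ) : (0 : ℝ) < (P.E n).card := by
  exact_mod_cast (P.nonempty n).card_pos

theorem stairPos_injective {n i i' : ℕ} {e e' : ℤ} (he : 0 ≤ e ∧ e < P.h n)
    (he' : 0 ≤ e' ∧ e' < P.h n)
    (h : e + stairPos (P.w n) i = e' + stairPos (P.w n) i') : i = i' ∧ e = e' := by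
  have hw := P.h_le_w n
  have : i = i' := by
    rcases lt_trichotomy i i' with hi | hi | hi
    · have := stairPos_add_le (w := P.w n) hi
      omega
    · exact hi
    · have := stairPos_add_le (w := P.w n) hi
      omega
  subst this
  exact ⟨rfl, by linarith⟩

theorem sum_E_succ (n : ℕ) (f : ℤ → ℝ) :
    ∑ x ∈ P.E (n + 1), f x =
      ∑ i ∈ Finset.range (P.r n), ∑ e ∈ P.E n, f (e + stairPos (P.w n) i) := by
  rw [P.E_succ, Finset.image₂, Finset.sum_image, Finset.sum_product_right]
  · rfl
  · rintro ⟨e, i⟩ hx ⟨e', i'⟩ hy hxy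
    have hx := Finset.mem_product.1 (Finset.mem_coe.1 hx)
    have hy := Finset.mem_product.1 (Finset.mem_coe.1 hy)
    obtain ⟨h1, h2⟩ := P.stairPos_injective (P.mem_bounds hx.1) (P.mem_bounds hy.1) hxy
    simp only at h1 h2
    rw [h1, h2]

theorem card_E_succ (n : ℕ) : ((P.E (n + 1)).card : ℝ) = P.r n * (P.E n).card := by
  have := P.sum_E_succ n fun _ => 1
  simpa using this

theorem indicator_E_succ (n : ℕ) (y : ℤ) : (if y ∈ P.E (n + 1) then (1 : ℝ) else 0) =
    ∑ i ∈ Finset.range (P.r n), if y - stairPos (P.w n) i ∈ P.E n then (1 : ℝ) else 0 := by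
  have := P.sum_E_succ n fun x => if y = x then 1 else 0
  rw [Finset.sum_ite_eq] at this
  rw [this]
  refine Finset.sum_congr rfl fun i _ => ?_
  simp_rw [← sub_eq_iff_eq_add]
  rw [Finset.sum_ite_eq]

theorem corr_nonneg (n : ℕ) (k : ℤ) : 0 ≤ P.corr n k := autocorr_nonneg _ _

theorem corr_eq_zero {n : ℕ} {k : ℤ} (hk : (P.h n : ℤ) ≤ |k|) : P.corr n k = 0 :=
  autocorr_eq_zero (P.subset_Ico n) hk

theorem card_mul_corr (n : ℕ) (k : ℤ) :
    (P.E n).card * P.corr n k = ∑ x ∈ P.E n, if x + k ∈ P.E n then (1 : ℝ) else 0 :=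
  mul_div_cancel₀ _ (P.card_pos n).ne'

/-- The correlations in a tower in terms of the preceding tower. -/
theorem corr_succ (n : ℕ) (k : ℤ) : P.r n * P.corr (n + 1) k =
    ∑ j ∈ Finset.range (P.r n), ∑ i ∈ Finset.range (P.r n),
      P.corr n (k + stairPos (P.w n) j - stairPos (P.w n) i) := by
  have h := P.card_mul_corr (n + 1) k
  rw [P.card_E_succ, P.sum_E_succ] at h
  refine mul_left_cancel₀ (P.card_pos n).ne' ?_
  rw [← mul_assoc, mul_comm ((P.E n).card : ℝ), h, Finset.mul_sum]
  refine Finset.sum_congr rfl fun j _ => ?_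
  simp_rw [P.indicator_E_succ, Finset.mul_sum, P.card_mul_corr]
  rw [Finset.sum_comm]
  refine Finset.sum_congr rfl fun i _ => Finset.sum_congr rfl fun e _ => ?_
  congr 2
  ring

theorem r_pos (n : ℕ) : (0 : ℝ) < P.r n := by
  have := P.two_le_r n
  positivity

theorem corr_le_succ (n : ℕ) (k : ℤ) : P.corr n k ≤ P.corr (n + 1) k := by
  refine le_of_mul_le_mul_left ?_ (P.r_pos n)
  rw [P.corr_succ]
  have : ∀ j ∈ Finset.range (P.r n), P.corr n k ≤ ∑ i ∈ Finset.range (P.r n),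
      P.corr n (k + stairPos (P.w n) j - stairPos (P.w n) i) := by
    intro j hj
    refine le_trans (le_of_eq ?_) (Finset.single_le_sum (fun i _ => P.corr_nonneg n _) hj)
    congr 1
    ring
  have := Finset.sum_le_sum this
  simpa using this

theorem corr_mono {n m : ℕ} (h : n ≤ m) (k : ℤ) : P.corr n k ≤ P.corr m k :=
  monotone_nat_of_le_succ (f := fun n => P.corr n k) (fun n => P.corr_le_succ n k) h

/-! ### Counting in windows -/

/-- A tower is made of translates of any earlier tower at mutual distances not less than the height
of the latter. -/
theorem exists_blocks (n : ℕ) {m : ℕ} (hm : n ≤ m) : ∃ C : Finset ℤ,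
    (∀ y ∈ P.E m, ∃ c ∈ C, y - c ∈ P.E n) ∧ (∀ c ∈ C, 0 ≤ c ∧ c + P.h n ≤ P.h m) ∧
    ∀ c ∈ C, ∀ c' ∈ C, c < c' → c + P.h n ≤ c' := by
  induction m, hm using Nat.le_induction with
  | base => exact ⟨{0}, by simp⟩
  | succ m hm ih =>
    obtain ⟨C, h1, h2, h3⟩ := ih
    have hw := P.h_le_w m
    refine ⟨Finset.image₂ (fun c i => c + stairPos (P.w m) i) C (Finset.range (P.r m)),
      ?_, ?_, ?_⟩
    · intro y hy
      rw [P.E_succ] at hy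
      obtain ⟨e, he, i, hi, rfl⟩ := Finset.mem_image₂.1 hy
      obtain ⟨c, hc, hce⟩ := h1 e he
      refine ⟨_, Finset.mem_image₂_of_mem hc hi, ?_⟩
      convert hce using 1
      simp only [w]
      ring
    · intro y hy
      obtain ⟨c, hc, i, hi, rfl⟩ := Finset.mem_image₂.1 hy
      have := stairPos_add_le (w := P.w m) (Finset.mem_range.1 hi)
      rw [← P.h_succ_eq] at this
      have := stairPos_nonneg (P.w m) i
      have := h2 c hc
      omega
    · intro y hy y' hy' hlt
      obtain ⟨c, hc, i, hi, rfl⟩ := Finset.mem_image₂.1 hy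
      obtain ⟨c', hc', i', hi', rfl⟩ := Finset.mem_image₂.1 hy'
      have b := h2 c hc
      have b' := h2 c' hc'
      rcases lt_trichotomy i i' with h | h | h
      · have := stairPos_add_le (w := P.w m) h
        omega
      · subst h
        have := h3 c hc c' hc' (by omega)
        omega
      · have := stairPos_add_le (w := P.w m) h
        omega

theorem card_window_le {n m : ℕ} (hm : n ≤ m) (v : ℤ) :
    ((P.E m).filter fun y => v ≤ y ∧ y < v + P.h n).card ≤ 2 * (P.E n).card := by
  obtain ⟨C, h1, -, h3⟩ := P.exists_blocks n hm
  have hC : (C.filter fun c => v - P.h n < c ∧ c < v + P.h n).card ≤ 2 := by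
    by_contra! hcard
    obtain ⟨a, ha, b, hb, c, hc, hab, hac, hbc⟩ := Finset.two_lt_card.1 hcard
    rw [Finset.mem_filter] at ha hb hc
    have := h3 a ha.1 b hb.1
    have := h3 b hb.1 a ha.1
    have := h3 a ha.1 c hc.1
    have := h3 c hc.1 a ha.1
    have := h3 b hb.1 c hc.1
    have := h3 c hc.1 b hb.1
    omega
  refine le_trans (Finset.card_le_card (t := (C.filter fun c => v - P.h n < c ∧ c < v + P.h n).biUnion
    fun c => (P.E n).image fun e => e + c) ?_) ?_
  · intro y hy
    obtain ⟨hy, hv⟩ := Finset.mem_filter.1 hy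
    obtain ⟨c, hc, hce⟩ := h1 y hy
    have := P.mem_bounds hce
    refine Finset.mem_biUnion.2 ⟨c, Finset.mem_filter.2 ⟨hc, by omega, by omega⟩,
      Finset.mem_image.2 ⟨y - c, hce, by ring⟩⟩
  · refine Finset.card_biUnion_le.trans ?_
    refine (Finset.sum_le_card_nsmul _ _ (P.E n).card fun c _ => Finset.card_image_le).trans ?_
    exact Nat.mul_le_mul_right _ hC

theorem card_window_mul_le {n m : ℕ} (hm : n ≤ m) (q : ℕ) (v : ℤ) :
    ((P.E m).filter fun y => v ≤ y ∧ y < v + (q * P.h n : ℕ)).card ≤ q * (2 * (P.E n).card) := by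
  induction q generalizing v with
  | zero => simp
  | succ q ih =>
    have hsub : ((P.E m).filter fun y => v ≤ y ∧ y < v + ((q + 1) * P.h n : ℕ)) ⊆
        ((P.E m).filter fun y => v ≤ y ∧ y < v + (q * P.h n : ℕ)) ∪
        ((P.E m).filter fun y => v + (q * P.h n : ℕ) ≤ y ∧ y < v + (q * P.h n : ℕ) + P.h n) := by
      intro y hy
      rw [Finset.mem_union, Finset.mem_filter, Finset.mem_filter]
      obtain ⟨hy, h1, h2⟩ := Finset.mem_filter.1 hy
      rw [add_mul, one_mul, Nat.cast_add] at h2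
      by_cases h : y < v + (q * P.h n : ℕ)
      · exact Or.inl ⟨hy, h1, h⟩
      · exact Or.inr ⟨hy, by omega, by omega⟩
    refine (Finset.card_le_card hsub).trans ((Finset.card_union_le _ _).trans ?_)
    have := ih v
    have := P.card_window_le hm (v + (q * P.h n : ℕ))
    linarith

theorem sum_corr_Ico_le {n N : ℕ} (hN : P.h n ≤ N) (m : ℕ) (u : ℤ) :
    ∑ t ∈ Finset.Ico u (u + N), P.corr m t ≤ 4 * ((P.E n).card / P.h n : ℝ) * N := by
  have hmono : ∑ t ∈ Finset.Ico u (u + N), P.corr m t ≤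
      ∑ t ∈ Finset.Ico u (u + N), P.corr (max n m) t :=
    Finset.sum_le_sum fun t _ => P.corr_mono (le_max_right _ _) t
  refine hmono.trans (sum_autocorr_Ico_le (by positivity) (fun v => ?_) u)
  have hh := P.h_pos n
  have hlt := Nat.lt_mul_div_succ N hh
  have h1 : ((P.E (max n m)).filter fun y => v ≤ y ∧ y < v + N).card ≤
      (N / P.h n + 1) * (2 * (P.E n).card) := by
    refine le_trans (Finset.card_le_card ?_)
      (P.card_window_mul_le (le_max_left n m) (N / P.h n + 1) v)
    refine Finset.monotone_filter_right _ fun y _ hy => ⟨hy.1, hy.2.trans ?_⟩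
    rw [mul_comm] at hlt
    have : (N : ℤ) < ((N / P.h n + 1) * P.h n : ℕ) := by exact_mod_cast hlt
    omega
  have hh' : (0 : ℝ) < P.h n := by exact_mod_cast hh
  have h2 : ((N / P.h n + 1 : ℕ) : ℝ) ≤ 2 * (N / P.h n) := by
    have a : ((N / P.h n : ℕ) : ℝ) ≤ N / P.h n := Nat.cast_div_le
    have b : (1 : ℝ) ≤ N / P.h n := by
      rw [le_div_iff₀ hh', one_mul]
      exact_mod_cast hN
    push_cast
    linarith
  calc (((P.E (max n m)).filter fun y => v ≤ y ∧ y < v + N).card : ℝ)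
      ≤ (N / P.h n + 1 : ℕ) * (2 * (P.E n).card) := by exact_mod_cast h1
    _ ≤ 2 * (N / P.h n) * (2 * (P.E n).card) := by gcongr
    _ = _ := by ring

/-! ### Small correlations -/

/-- If a set is thin in the towers, its correlations are small on average over long intervals,
uniformly in the location of the interval and in the tower. -/
theorem exists_sum_corr_Ico_le (hE : Tendsto (fun n => ((P.E n).card : ℝ) / P.h n) atTop (𝓝 0))
    {η : ℝ} (hη : 0 < η) : ∃ N₀ : ℕ, ∀ N ≥ N₀, ∀ (m : ℕ) (u : ℤ),
      ∑ t ∈ Finset.Ico u (u + N), P.corr m t ≤ η * N := by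
  obtain ⟨n, hn⟩ := (hE.eventually_lt_const (show (0 : ℝ) < η / 4 by positivity)).exists
  refine ⟨P.h n, fun N hN m u => (P.sum_corr_Ico_le hN m u).trans ?_⟩
  gcongr
  linarith

theorem exists_sum_corr_progression_le
    (hE : Tendsto (fun n => ((P.E n).card : ℝ) / P.h n) atTop (𝓝 0)) (K : ℕ)
    {δ : ℝ} (hδ : 0 < δ) : ∃ L₀ : ℕ, ∀ L ≥ L₀, ∀ d : ℕ, 0 < d → d ≤ K → ∀ (m : ℕ) (k : ℤ),
      ∑ j ∈ Finset.range L, P.corr m (k - j * d) ≤ δ * L := by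
  obtain ⟨N₀, hN₀⟩ := P.exists_sum_corr_Ico_le hE (η := δ / (K + 1)) (by positivity)
  refine ⟨N₀, fun L hL d hd hdK m k => (sum_autocorr_progression_le hd k).trans ?_⟩
  refine (hN₀ (d * L) (hL.trans (Nat.le_mul_of_pos_left L hd)) m _).trans ?_
  have hdK' : (d : ℝ) ≤ K := by exact_mod_cast hdK
  rw [div_mul_eq_mul_div, div_le_iff₀ (by positivity)]
  push_cast
  have : (0 : ℝ) ≤ δ * L := by positivity
  nlinarith

/-- The proportion of the points which are less than `k` levels below the top of the tower. -/
def nearTop (n : ℕ) (k : ℤ) : ℝ :=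
  (∑ x ∈ P.E n, if (P.h n : ℤ) ≤ x + k then (1 : ℝ) else 0) / (P.E n).card

theorem card_mul_nearTop (n : ℕ) (k : ℤ) : (P.E n).card * P.nearTop n k =
    ∑ x ∈ P.E n, if (P.h n : ℤ) ≤ x + k then (1 : ℝ) else 0 :=
  mul_div_cancel₀ _ (P.card_pos n).ne'

theorem nearTop_nonneg (n : ℕ) (k : ℤ) : 0 ≤ P.nearTop n k := by
  unfold nearTop; positivity

theorem nearTop_le_one (n : ℕ) (k : ℤ) : P.nearTop n k ≤ 1 := by
  rw [nearTop, Finset.sum_boole]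
  refine div_le_one_of_le₀ ?_ (by positivity)
  exact_mod_cast Finset.card_filter_le _ _

theorem corr_succ_le_add_nearTop {n : ℕ} {k : ℤ} (hk : 0 ≤ k) :
    P.corr (n + 1) k ≤ P.corr n k + P.nearTop n k := by
  have h := P.card_mul_corr (n + 1) k
  rw [P.card_E_succ, P.sum_E_succ] at h
  have hpt : ∀ i ∈ Finset.range (P.r n), ∑ e ∈ P.E n,
      (if e + stairPos (P.w n) i + k ∈ P.E (n + 1) then (1 : ℝ) else 0) ≤
      (P.E n).card * (P.corr n k + P.nearTop n k) := by
    intro i _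
    rw [mul_add, P.card_mul_corr, P.card_mul_nearTop, ← Finset.sum_add_distrib]
    refine Finset.sum_le_sum fun e he => ?_
    have he := P.mem_bounds he
    by_cases h1 : (P.h n : ℤ) ≤ e + k
    · rw [if_pos h1]
      split_ifs <;> norm_num
    · rw [if_neg h1, add_zero]
      by_cases h2 : e + stairPos (P.w n) i + k ∈ P.E (n + 1)
      · rw [if_pos h2]
        rw [P.E_succ] at h2
        obtain ⟨e', he', i', -, h3⟩ := Finset.mem_image₂.1 h2
        have h4 := (P.stairPos_injective (n := n) (i := i') (i' := i) (P.mem_bounds he')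
          (e' := e + k) ⟨by omega, by omega⟩ (by simp only [w] at h3 ⊢; linarith)).2
        rw [← h4, if_pos he']
      · rw [if_neg h2]
        split_ifs <;> norm_num
  have h5 := Finset.sum_le_sum hpt
  rw [← h, Finset.sum_const, Finset.card_range, nsmul_eq_mul, mul_assoc] at h5
  exact le_of_mul_le_mul_left (le_of_mul_le_mul_left h5 (P.r_pos n)) (P.card_pos n)

theorem nearTop_succ_le {n : ℕ} {k : ℤ} (hk : k < P.h n) :
    P.r n * P.nearTop (n + 1) k ≤ P.nearTop n k := by
  have h := P.card_mul_nearTop (n + 1) k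
  rw [P.card_E_succ, P.sum_E_succ] at h
  have hw := P.h_le_w n
  have hr := P.two_le_r n
  have hpt : ∀ i ∈ Finset.range (P.r n), ∑ e ∈ P.E n,
      (if (P.h (n + 1) : ℤ) ≤ e + stairPos (P.w n) i + k then (1 : ℝ) else 0) ≤
      if P.r n - 1 = i then (P.E n).card * P.nearTop n k else 0 := by
    intro i hi
    have hi := Finset.mem_range.1 hi
    split_ifs with hir
    · rw [P.card_mul_nearTop]
      refine Finset.sum_le_sum fun e he => ?_
      have h1 := stairPos_add_le (w := P.w n) hi
      rw [← P.h_succ_eq] at h1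
      by_cases h2 : (P.h n : ℤ) ≤ e + k
      · rw [if_pos h2]
        split_ifs <;> norm_num
      · rw [if_neg h2, if_neg (by omega)]
    · refine (Finset.sum_eq_zero fun e he => if_neg ?_).le
      have h1 := stairPos_add_two_mul_le (w := P.w n) (show i + 2 ≤ P.r n by omega)
      rw [← P.h_succ_eq] at h1
      have := P.mem_bounds he
      omega
  have h5 := Finset.sum_le_sum hpt
  rw [← h, Finset.sum_ite_eq, if_pos (Finset.mem_range.2 (by omega)), mul_comm (P.r n : ℝ),
    mul_assoc] at h5
  exact le_of_mul_le_mul_left h5 (P.card_pos n)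

/-- Passing to higher towers increases the correlation at `k` only by the proportion of points near
the top of a tower, which decreases geometrically. -/
theorem corr_le_add_two_div {n : ℕ} {k : ℤ} (hk : 0 ≤ k) (hkh : k < P.h n) (m : ℕ) :
    P.corr m k ≤ P.corr (n + 1) k + 2 / P.r n := by
  have hr : (0 : ℝ) < P.r n := P.r_pos n
  rcases le_total m (n + 1) with hm | hm
  · have := P.corr_mono hm k
    have : (0 : ℝ) ≤ 2 / P.r n := by positivity
    linarith
  have key : P.corr m k + 2 * P.nearTop m k ≤ P.corr (n + 1) k + 2 * P.nearTop (n + 1) k := by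
    induction m, hm using Nat.le_induction with
    | base => exact le_rfl
    | succ m hm ih =>
      have h1 := P.corr_succ_le_add_nearTop (n := m) hk
      have hlt : (P.h n : ℤ) ≤ P.h m := by exact_mod_cast P.h_strictMono.monotone (by omega)
      have h2 := P.nearTop_succ_le (n := m) (k := k) (by omega)
      have h3 : (2 : ℝ) ≤ P.r m := by exact_mod_cast P.two_le_r m
      have h4 := P.nearTop_nonneg (m + 1) k
      nlinarith
  have h1 := P.nearTop_succ_le hkh
  have h2 := P.nearTop_le_one n k
  have h3 : P.nearTop (n + 1) k ≤ 1 / P.r n := by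
    rw [le_div_iff₀ hr]
    linarith
  have h4 := P.nearTop_nonneg m k
  have : (2 : ℝ) / P.r n = 2 * (1 / P.r n) := by ring
  linarith

/-- For `0 ≤ k < h n` only neighbouring copies of the tower contribute to the correlation at
`k`. -/
theorem corr_succ_le_of_lt {n : ℕ} {k : ℤ} (hk : 0 ≤ k) (hkh : k < P.h n) :
    P.r n * P.corr (n + 1) k ≤ P.r n * P.corr n k +
      ∑ j ∈ Finset.range (P.r n), P.corr n (k - P.w n - j * (1 : ℕ)) := by
  rw [P.corr_succ]
  have hw := P.h_le_w n
  have hpt : ∀ j ∈ Finset.range (P.r n), ∑ i ∈ Finset.range (P.r n),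
      P.corr n (k + stairPos (P.w n) j - stairPos (P.w n) i) ≤
      P.corr n k + P.corr n (k - P.w n - j * (1 : ℕ)) := by
    intro j _
    have e1 : k = k + stairPos (P.w n) j - stairPos (P.w n) j := by ring
    have e2 : k - P.w n - j * (1 : ℕ) =
        k + stairPos (P.w n) j - stairPos (P.w n) (j + 1) := by
      rw [stairPos_add]
      simp [triangle]
      ring
    rw [e2]
    nth_rewrite 2 [e1]
    rw [← Finset.sum_pair
      (f := fun i => P.corr n (k + stairPos (P.w n) j - stairPos (P.w n) i))
      (show j ≠ j + 1 by omega)]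
    refine sum_le_sum_of_support (fun _ => P.corr_nonneg _ _) fun i _ hi => ?_
    by_contra hij
    rw [Finset.mem_insert, Finset.mem_singleton, not_or] at hij
    refine hi (P.corr_eq_zero ?_)
    rcases lt_or_gt_of_ne hij.1 with h | h
    · have := stairPos_add_le (w := P.w n) h
      exact le_trans (by omega) (le_abs_self _)
    · have := stairPos_add_two_mul_le (w := P.w n) (show j + 2 ≤ i by omega)
      exact le_trans (by omega) (neg_le_abs _)
  refine (Finset.sum_le_sum hpt).trans_eq ?_
  rw [Finset.sum_add_distrib]
  simp

/-- For `k` less than the height of the `n`-th tower, the correlation at `k` in all towers is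
almost the one in the `n`-th tower, if `n` is large. -/
theorem exists_corr_le_corr_add (hr : Tendsto P.r atTop atTop)
    (hE : Tendsto (fun n => ((P.E n).card : ℝ) / P.h n) atTop (𝓝 0)) {δ : ℝ} (hδ : 0 < δ) :
    ∃ n₀ : ℕ, ∀ n ≥ n₀, ∀ k : ℤ, 0 ≤ k → k < P.h n → ∀ m, P.corr m k ≤ P.corr n k + δ := by
  obtain ⟨L₀, hL₀⟩ := P.exists_sum_corr_progression_le hE 1 (δ := δ / 2) (by positivity)
  obtain ⟨n₀, hn₀⟩ := eventually_atTop.1 (hr.eventually_ge_atTop (max L₀ ⌈4 / δ⌉₊))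
  refine ⟨n₀, fun n hn k hk hkh m => ?_⟩
  have h1 := hn₀ n hn
  have h2 := hL₀ (P.r n) (le_trans (le_max_left _ _) h1) 1 one_pos le_rfl n (k - P.w n)
  have h3 := P.corr_succ_le_of_lt hk hkh
  have h4 := P.corr_le_add_two_div hk hkh m
  have h5 : 4 / δ ≤ P.r n :=
    (Nat.le_ceil _).trans (by exact_mod_cast le_trans (le_max_right _ _) h1)
  have hr := P.r_pos n
  have h6 : 2 / (P.r n : ℝ) ≤ δ / 2 := by
    rw [div_le_iff₀ hδ] at h5
    rw [div_le_iff₀ hr]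
    linarith
  have h7 : P.corr (n + 1) k ≤ P.corr n k + δ / 2 := by
    refine le_of_mul_le_mul_left ?_ hr
    rw [mul_add, mul_comm _ (δ / 2)]
    exact h3.trans (by gcongr)
  linarith

/-- For `k ≥ h n` the correlation at `k` in tower `n + 1` is a sum of sums of correlations along
progressions, whose step `d` is the distance of the indices of two copies of tower `n`. -/
theorem corr_succ_le_sum {n : ℕ} {k : ℤ} (hk : (P.h n : ℤ) ≤ k) :
    P.r n * P.corr (n + 1) k ≤ ∑ d ∈ Finset.Ico 1 (P.r n), ∑ j ∈ Finset.range (P.r n),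
      P.corr n (k - d * P.w n - triangle d - j * d) := by
  rw [P.corr_succ, Finset.sum_comm (s := Finset.Ico 1 (P.r n))]
  refine Finset.sum_le_sum fun j hj => ?_
  have hj := Finset.mem_range.1 hj
  have h1 : ∑ i ∈ Finset.range (P.r n),
      P.corr n (k + stairPos (P.w n) j - stairPos (P.w n) i) ≤
      ∑ i ∈ Finset.Ico (j + 1) (j + P.r n),
        P.corr n (k + stairPos (P.w n) j - stairPos (P.w n) i) := by
    refine sum_le_sum_of_support (fun _ => P.corr_nonneg _ _) fun i hir hi => ?_
    have hir := Finset.mem_range.1 hir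
    rw [Finset.mem_Ico]
    refine ⟨?_, by omega⟩
    by_contra hij
    refine hi (P.corr_eq_zero (le_trans ?_ (le_abs_self _)))
    rcases (show i ≤ j by omega).eq_or_lt with rfl | h
    · omega
    · have := stairPos_add_le (w := P.w n) h
      omega
  refine h1.trans (le_of_eq ?_)
  rw [add_comm j 1, add_comm j (P.r n), ← Finset.sum_Ico_add']
  refine Finset.sum_congr rfl fun d _ => ?_
  congr 1
  rw [add_comm d j, stairPos_add]
  ring

/-- Only three steps `d` contribute to the correlation at `k ≥ h n` in tower `n + 1`. -/
theorem corr_succ_le_three_mul {n : ℕ} {k : ℕ} (hk : P.h n ≤ k)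
    (hrn : 2 * P.r n ^ 2 ≤ P.h n) {δ : ℝ} (hδ : 0 ≤ δ)
    (hd : ∀ d : ℕ, 1 ≤ d → d < P.r n → d ≤ k / P.w n + 1 → ∀ k' : ℤ,
      ∑ j ∈ Finset.range (P.r n), P.corr n (k' - j * d) ≤ δ * P.r n) :
    P.corr (n + 1) k ≤ 3 * δ := by
  have hw := P.h_le_w n
  set d₀ := k / P.w n with hd₀
  have h1 := P.corr_succ_le_sum (k := k) (by exact_mod_cast hk)
  have h2 : ∑ d ∈ Finset.Ico 1 (P.r n), ∑ j ∈ Finset.range (P.r n),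
      P.corr n ((k : ℤ) - d * P.w n - triangle d - j * d) ≤
      ∑ d ∈ ({d₀ - 1, d₀, d₀ + 1} : Finset ℕ), δ * P.r n := by
    have hw0 := P.w_pos n
    have hlow : d₀ * P.w n ≤ k := Nat.div_mul_le_self _ _
    have hup : k < P.w n * (d₀ + 1) := Nat.lt_mul_div_succ k hw0
    have hle : ∀ d ∈ Finset.Ico 1 (P.r n), ∑ j ∈ Finset.range (P.r n),
        P.corr n ((k : ℤ) - d * P.w n - triangle d - j * d) ≤
        if d ∈ ({d₀ - 1, d₀, d₀ + 1} : Finset ℕ) then δ * P.r n else 0 := by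
      intro d hdr
      have hdr := Finset.mem_Ico.1 hdr
      split_ifs with hmem
      · refine hd d hdr.1 hdr.2 ?_ _
        simp only [Finset.mem_insert, Finset.mem_singleton] at hmem
        omega
      · simp only [Finset.mem_insert, Finset.mem_singleton, not_or] at hmem
        refine (Finset.sum_eq_zero fun j hj => P.corr_eq_zero ?_).le
        have hj := Finset.mem_range.1 hj
        have hjd : j * d ≤ P.r n ^ 2 := by
          rw [sq]; exact Nat.mul_le_mul hj.le hdr.2.le
        have htri : triangle d ≤ P.r n ^ 2 :=
          (triangle_le d).trans (Nat.pow_le_pow_left hdr.2.le 2)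
        zify at hjd htri hrn hlow hup hw
        have h0 : (0 : ℤ) ≤ j * d := by positivity
        rcases lt_or_ge d (d₀ - 1) with h | h
        · have h3 : ((d : ℤ) + 2) * P.w n ≤ d₀ * P.w n := by gcongr; omega
          refine le_trans ?_ (le_abs_self _)
          linarith
        · have h3 : ((d₀ : ℤ) + 2) * P.w n ≤ d * P.w n := by gcongr; omega
          refine le_trans ?_ (neg_le_abs _)
          linarith [Int.natCast_nonneg (triangle d)]
    refine (Finset.sum_le_sum hle).trans ?_
    rw [← Finset.sum_filter]
    refine Finset.sum_le_sum_of_subset_of_nonneg ?_ fun _ _ _ => by positivity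
    exact fun d hd => (Finset.mem_filter.1 hd).2
  have h3 : ∑ d ∈ ({d₀ - 1, d₀, d₀ + 1} : Finset ℕ), δ * P.r n ≤ 3 * (δ * P.r n) := by
    rw [Finset.sum_const, nsmul_eq_mul]
    gcongr
    exact_mod_cast Finset.card_le_three
  refine le_of_mul_le_mul_left ?_ (P.r_pos n)
  linarith

theorem eventually_mul_sq_le (hrh : Tendsto (fun n => (P.r n : ℝ) ^ 2 / P.h n) atTop (𝓝 0))
    (K : ℕ) : ∀ᶠ n in atTop, K * P.r n ^ 2 ≤ P.h n := by
  filter_upwards [hrh.eventually_lt_const (show (0 : ℝ) < 1 / (K + 1) by positivity)] with n hn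
  have hh : (0 : ℝ) < P.h n := by exact_mod_cast P.h_pos n
  rw [div_lt_div_iff₀ hh (by positivity)] at hn
  have : ((K * P.r n ^ 2 : ℕ) : ℝ) ≤ P.h n := by
    push_cast
    nlinarith [sq_nonneg (P.r n : ℝ)]
  exact_mod_cast this

/-- The correlations are small at all times between `h p` and a fixed multiple of `w p`. -/
theorem exists_corr_le_of_le_mul (hr : Tendsto P.r atTop atTop)
    (hrh : Tendsto (fun n => (P.r n : ℝ) ^ 2 / P.h n) atTop (𝓝 0))
    (hE : Tendsto (fun n => ((P.E n).card : ℝ) / P.h n) atTop (𝓝 0)) (K : ℕ) {ε : ℝ}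
    (hε : 0 < ε) : ∃ p₀ : ℕ, ∀ p ≥ p₀, ∀ k : ℕ, P.h p ≤ k → k ≤ K * P.w p →
      ∀ m, P.corr m k ≤ ε := by
  obtain ⟨L₀, hL₀⟩ := P.exists_sum_corr_progression_le hE (K + 1) (δ := ε / 6) (by positivity)
  obtain ⟨n₀, hn₀⟩ := P.exists_corr_le_corr_add hr hE (δ := ε / 2) (by positivity)
  obtain ⟨p₀, hp₀⟩ := eventually_atTop.1
    ((hr.eventually_ge_atTop (max L₀ (K + 1))).and (P.eventually_mul_sq_le hrh 2))
  refine ⟨max p₀ n₀, fun p hp k hk hkK m => ?_⟩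
  obtain ⟨h1, h2⟩ := hp₀ p (le_trans (le_max_left _ _) hp)
  have hw := P.w_pos p
  have h3 : P.corr (p + 1) k ≤ 3 * (ε / 6) := by
    refine P.corr_succ_le_three_mul hk h2 (by positivity) fun d hd _ hdk k' =>
      hL₀ _ (le_trans (le_max_left _ _) h1) d hd ?_ p k'
    have : k / P.w p ≤ K := Nat.div_le_of_le_mul (by rwa [mul_comm])
    omega
  have h4 : k < P.h (p + 1) := by
    have h5 : (K + 1) * P.w p ≤ P.r p * P.w p :=
      Nat.mul_le_mul_right _ (le_trans (le_max_right _ _) h1)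
    have := P.mul_w_le p
    rw [add_mul, one_mul] at h5
    omega
  have h5 := hn₀ (p + 1) (le_trans (le_max_right p₀ n₀) (by omega)) k (by positivity)
    (by exact_mod_cast h4) m
  linarith

theorem exists_h_le_lt {p₀ : ℕ} {k : ℕ} (hk : P.h p₀ ≤ k) :
    ∃ p ≥ p₀, P.h p ≤ k ∧ k < P.h (p + 1) := by
  have hex : ∃ p, k < P.h p := by
    refine ⟨k + 1, ?_⟩
    have := P.h_strictMono.id_le (k + 1)
    simp only [id] at this
    omega
  have hlt := Nat.find_spec hex
  have hgt : p₀ < Nat.find hex := by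
    by_contra! h
    have := P.h_strictMono.monotone h
    omega
  obtain ⟨p, hp⟩ := Nat.exists_eq_add_of_lt hgt
  have hmin := Nat.find_min hex (m := p₀ + p) (by omega)
  rw [hp] at hlt
  exact ⟨p₀ + p, by omega, by omega, hlt⟩

/-- Averages of the correlations along progressions of length `r n` whose step is less than `r n`
are uniformly small.

A bounded step `d` is covered by the smallness on intervals.  Otherwise `h p ≤ d < h (p + 1)` for
some large `p`, and there is a multiple `q * d`, with `q` of smaller order than `r n`, whose first
multiples lie in the range where the correlations are small: `q = 1` if `d` is less than `w p`,
and else the least `q` with `h (p + 1) ≤ q * d`, which does not exceed `2 * r p`; here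
`r p ^ 2 ≤ h p ≤ d < r n`. -/
theorem exists_sum_corr_le_of_lt_r (hr : Tendsto P.r atTop atTop)
    (hrh : Tendsto (fun n => (P.r n : ℝ) ^ 2 / P.h n) atTop (𝓝 0))
    (hE : Tendsto (fun n => ((P.E n).card : ℝ) / P.h n) atTop (𝓝 0)) {δ : ℝ} (hδ : 0 < δ) :
    ∃ n₀ : ℕ, ∀ n ≥ n₀, ∀ d : ℕ, 1 ≤ d → d < P.r n → ∀ (m : ℕ) (k : ℤ),
      ∑ j ∈ Finset.range (P.r n), P.corr m (k - j * d) ≤ δ * P.r n := by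
  obtain ⟨M, hM⟩ := exists_nat_ge (8 / δ ^ 2)
  have hM0 : (0 : ℝ) < M := lt_of_lt_of_le (by positivity) hM
  have hM1 : 0 < M := by exact_mod_cast hM0
  -- With this `ε` the hypothesis `M + M ^ 2 * ε ≤ (M * (δ / 2)) ^ 2` of the block lemma holds.
  set ε : ℝ := δ ^ 2 / 8 with hε
  have hε0 : 0 < ε := by positivity
  have hMε : M + M ^ 2 * ε ≤ (M * (δ / 2)) ^ 2 := by
    rw [div_le_iff₀ (by positivity)] at hM
    rw [hε]
    nlinarith
  obtain ⟨p₁, hp₁⟩ := P.exists_corr_le_of_le_mul hr hrh hE (2 * M) hε0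
  obtain ⟨p₂, hp₂⟩ := eventually_atTop.1 (P.eventually_mul_sq_le hrh 1)
  set p₀ := max p₁ p₂
  obtain ⟨L₀, hL₀⟩ := P.exists_sum_corr_progression_le hE (P.h p₀) hδ
  obtain ⟨n₀, hn₀⟩ := eventually_atTop.1
    (hr.eventually_ge_atTop (max L₀ ⌈16 * M ^ 2 / δ ^ 2⌉₊))
  refine ⟨n₀, fun n hn d hd hdr m k => ?_⟩
  have hrn := hn₀ n hn
  rcases lt_or_ge d (P.h p₀) with hdp | hdp
  · exact hL₀ _ (le_trans (le_max_left _ _) hrn) d hd hdp.le m k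
  have hr0 := P.r_pos n
  have hrM : 16 * M ^ 2 / δ ^ 2 ≤ P.r n :=
    (Nat.le_ceil _).trans (by exact_mod_cast le_trans (le_max_right _ _) hrn)
  rw [div_le_iff₀ (by positivity)] at hrM
  -- A factor `q` of order at most `√(r n)` is negligible.
  suffices ∃ q : ℕ, q ^ 2 ≤ 4 * P.r n ∧
      ∀ i : ℕ, 1 ≤ i → i < M → P.corr m ((i * (q * d) : ℕ) : ℤ) ≤ ε by
    obtain ⟨q, hq, hqi⟩ := this
    refine (sum_autocorr_le_of_multiples (P.E m) hM1 (by positivity) hMε hqi hε0.le k _).trans ?_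
    have hq' : (q : ℝ) ^ 2 ≤ 4 * P.r n := by exact_mod_cast hq
    have : M * q ≤ δ / 2 * P.r n := by
      refine (abs_le_of_sq_le_sq' ?_ (by positivity)).2
      calc ((M : ℝ) * q) ^ 2 = (M : ℝ) ^ 2 * q ^ 2 := by ring
        _ ≤ (M : ℝ) ^ 2 * (4 * P.r n) := by gcongr
        _ = (16 * (M : ℝ) ^ 2) * P.r n / 4 := by ring
        _ ≤ (P.r n * δ ^ 2) * P.r n / 4 := by gcongr
        _ = _ := by ring
    linarith
  obtain ⟨p, hp, hpd, hdp1⟩ := P.exists_h_le_lt hdp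
  have hpp₁ : p₁ ≤ p := le_trans (le_max_left _ _) hp
  have hpp₂ : p₂ ≤ p := le_trans (le_max_right _ _) hp
  rcases lt_or_ge d (P.w p) with hdw | hdw
  · refine ⟨1, by omega, fun i hi hiM => hp₁ p hpp₁ _ ?_ ?_ m⟩
    · rw [one_mul]
      exact hpd.trans (Nat.le_mul_of_pos_left d hi)
    · rw [one_mul]
      exact Nat.mul_le_mul (by omega) hdw.le
  · have hmod : P.h (p + 1) < d * (P.h (p + 1) / d + 1) := Nat.lt_mul_div_succ _ (by omega)
    have hdiv : d * (P.h (p + 1) / d) ≤ P.h (p + 1) := Nat.mul_div_le _ _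
    set q := P.h (p + 1) / d + 1 with hq
    have hqd : q * d ≤ 2 * P.h (p + 1) := by
      rw [hq, add_mul, one_mul, mul_comm]
      omega
    refine ⟨q, ?_, fun i hi hiM => hp₁ (p + 1) (by omega) _ ?_ ?_ m⟩
    · have hp2 : 1 * P.r p ^ 2 ≤ P.h p := hp₂ p hpp₂
      have hr2 := P.two_le_r p
      have h1 : P.h (p + 1) ≤ d * (P.r p + 1) := by
        rw [P.h_succ, mul_add d, mul_one, mul_comm d]
        have := triangle_le (P.r p)
        refine add_le_add (Nat.mul_le_mul_left _ hdw) (by omega)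
      have h2 : P.h (p + 1) / d ≤ P.r p + 1 := Nat.div_le_of_le_mul h1
      have h3 : q ≤ 2 * P.r p := by omega
      calc q ^ 2 ≤ (2 * P.r p) ^ 2 := Nat.pow_le_pow_left h3 2
        _ = 4 * P.r p ^ 2 := by ring
        _ ≤ 4 * P.r n := by omega
    · rw [mul_comm q]
      exact hmod.le.trans (Nat.le_mul_of_pos_left _ hi)
    · calc i * (q * d) ≤ M * (2 * P.h (p + 1)) := Nat.mul_le_mul hiM.le hqd
        _ = 2 * M * P.h (p + 1) := by ring
        _ ≤ 2 * M * P.w (p + 1) := Nat.mul_le_mul_left _ (P.h_le_w _)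

/-- The correlations tend to zero, uniformly in the tower. -/
theorem exists_corr_le (hr : Tendsto P.r atTop atTop)
    (hrh : Tendsto (fun n => (P.r n : ℝ) ^ 2 / P.h n) atTop (𝓝 0))
    (hE : Tendsto (fun n => ((P.E n).card : ℝ) / P.h n) atTop (𝓝 0)) {ε : ℝ} (hε : 0 < ε) :
    ∃ k₀ : ℕ, ∀ k ≥ k₀, ∀ m, P.corr m (k : ℕ) ≤ ε := by
  obtain ⟨n₁, hn₁⟩ := P.exists_corr_le_corr_add hr hE (δ := ε / 4) (by positivity)
  obtain ⟨n₂, hn₂⟩ := P.exists_sum_corr_le_of_lt_r hr hrh hE (δ := ε / 4) (by positivity)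
  obtain ⟨n₃, hn₃⟩ := eventually_atTop.1 (P.eventually_mul_sq_le hrh 2)
  refine ⟨P.h (max n₁ (max n₂ n₃)), fun k hk m => ?_⟩
  obtain ⟨n, hn, hnk, hkn⟩ := P.exists_h_le_lt hk
  simp only [ge_iff_le, max_le_iff] at hn
  have h1 := hn₁ (n + 1) (by omega) k (by positivity) (by exact_mod_cast hkn) m
  have h2 := P.corr_succ_le_three_mul hnk (hn₃ n hn.2.2) (δ := ε / 4) (by positivity)
    fun d hd hdr _ k' => hn₂ n hn.2.1 d hd hdr n k'
  linarith

end StaircasePositions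

namespace CFData

variable (D : CFData)

/-! ### The embeddings of the towers -/

theorem pos_self {n : ℕ} (p : D.Tower n) : D.pos p n = p.1 := by simp [pos]

theorem pos_succ {n m : ℕ} (p : D.Tower n) (h : n ≤ m) :
    D.pos p (m + 1) = D.pos p m + p.2 ⟨m, h⟩ := by
  unfold pos
  rw [Finset.sum_Ico_succ_top h, dif_pos h, add_assoc]

theorem pos_mem {n m : ℕ} (h : n ≤ m) (p : D.Tower n) : D.pos p m ∈ D.F m := by
  induction m, h using Nat.le_induction with
  | base => rw [pos_self]; exact p.1.2
  | succ m h ih =>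
    rw [pos_succ D p h]
    exact D.add_mem m _ ih _ (p.2 ⟨m, h⟩).2

/-- The embedding `X_n → X_m` for `n ≤ m`. -/
def up {n m : ℕ} (h : n ≤ m) (p : D.Tower n) : D.Tower m :=
  (⟨D.pos p m, D.pos_mem h p⟩, fun k => p.2 ⟨k, h.trans k.2⟩)

theorem toSpace_up {n m : ℕ} (h : n ≤ m) (p : D.Tower n) :
    D.toSpace m (D.up h p) = D.toSpace n p :=
  Quotient.sound (s := D.towerSetoid) ⟨m, le_rfl, h, by rw [pos_self]; rfl, fun _ _ => rfl⟩

theorem eq_of_pos_eq {n N : ℕ} (hN : n ≤ N) (p q : D.Tower n) (h : D.pos p N = D.pos q N)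
    (ht : ∀ (k : ℕ) (hk : n ≤ k), N ≤ k → p.2 ⟨k, hk⟩ = q.2 ⟨k, hk⟩) : p = q := by
  induction N, hN using Nat.le_induction with
  | base =>
    rw [pos_self, pos_self] at h
    exact Prod.ext (Subtype.ext h) (funext fun k => ht k k.2 k.2)
  | succ N hN ih =>
    rw [pos_succ D p hN, pos_succ D q hN] at h
    have hc : p.2 ⟨N, hN⟩ = q.2 ⟨N, hN⟩ := by
      by_contra hne
      exact D.disjoint_translates N _ (p.2 ⟨N, hN⟩).2 _ (q.2 ⟨N, hN⟩).2
        (fun h' => hne (Subtype.ext h')) _ (D.pos_mem hN p) _ (D.pos_mem hN q) h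
    refine ih ?_ fun k hnk hk => ?_
    · rw [hc] at h
      exact add_right_cancel h
    · rcases hk.eq_or_lt with rfl | hk
      · exact hc
      · exact ht k hnk hk

theorem toSpace_injective (n : ℕ) : Function.Injective (D.toSpace n) := by
  intro p q hpq
  obtain ⟨N, ha, _, h, ht⟩ : D.Same ⟨n, p⟩ ⟨n, q⟩ := Quotient.exact hpq
  exact D.eq_of_pos_eq ha p q h fun k _ hk => Subtype.ext (ht k hk)

theorem up_injective {n m : ℕ} (h : n ≤ m) : Function.Injective (D.up h) := by
  intro p q hpq
  refine D.toSpace_injective n ?_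
  rw [← D.toSpace_up h, hpq, D.toSpace_up]

/-- The image of `X_n` in `X`. -/
def towerSet (n : ℕ) : Set D.Space := Set.range (D.toSpace n)

theorem towerSet_mono : Monotone D.towerSet := by
  rintro n m h _ ⟨p, rfl⟩
  exact ⟨D.up h p, D.toSpace_up h p⟩

theorem iUnion_towerSet : ⋃ n, D.towerSet n = Set.univ := by
  refine Set.eq_univ_of_forall fun x => ?_
  induction x using Quotient.inductionOn with
  | h a => exact Set.mem_iUnion.2 ⟨a.1, a.2, rfl⟩

theorem measurable_pos (n m : ℕ) : Measurable fun p : D.Tower n => D.pos p m := by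
  unfold pos
  refine Measurable.add (measurable_subtype_coe.comp measurable_fst)
    (Finset.measurable_sum _ fun k _ => ?_)
  by_cases hk : n ≤ k
  · simp only [hk, dif_pos]
    exact measurable_subtype_coe.comp ((measurable_pi_apply _).comp measurable_snd)
  · simp only [hk, dif_neg, not_false_eq_true]
    exact measurable_const

theorem measurable_up {n m : ℕ} (h : n ≤ m) : Measurable (D.up h) :=
  ((D.measurable_pos n m).subtype_mk).prodMk
    (measurable_pi_lambda _ fun _ => (measurable_pi_apply _).comp measurable_snd)

theorem measurableEmbedding_up {n m : ℕ} (h : n ≤ m) : MeasurableEmbedding (D.up h) :=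
  (D.measurable_up h).measurableEmbedding (D.up_injective h)

theorem measurableSet_space_iff {A : Set D.Space} :
    MeasurableSet A ↔ ∀ n, MeasurableSet (D.toSpace n ⁻¹' A) := by
  rw [MeasurableSpace.measurableSet_iInf]
  rfl

theorem measurable_toSpace (n : ℕ) : Measurable (D.toSpace n) :=
  fun _ hA => D.measurableSet_space_iff.1 hA n

theorem measurableEmbedding_toSpace (n : ℕ) : MeasurableEmbedding (D.toSpace n) where
  injective := D.toSpace_injective n
  measurable := D.measurable_toSpace n
  measurableSet_image' := by
    intro B hB
    refine D.measurableSet_space_iff.2 fun m => ?_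
    rcases le_total m n with h | h
    · have : D.toSpace m ⁻¹' (D.toSpace n '' B) = D.up h ⁻¹' B := by
        ext p
        rw [Set.mem_preimage, ← D.toSpace_up h, (D.toSpace_injective n).mem_set_image]
        rfl
      rw [this]
      exact D.measurable_up h hB
    · have : D.toSpace m ⁻¹' (D.toSpace n '' B) = D.up h '' B := by
        ext p
        constructor
        · rintro ⟨q, hq, hqp⟩
          exact ⟨q, hq, D.toSpace_injective m (by rw [D.toSpace_up, hqp])⟩
        · rintro ⟨q, hq, rfl⟩
          exact ⟨q, hq, (D.toSpace_up h q).symm⟩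
      rw [this]
      exact (D.measurableEmbedding_up h).measurableSet_image' hB

theorem measurableSet_towerSet (n : ℕ) : MeasurableSet (D.towerSet n) :=
  (D.measurableEmbedding_toSpace n).measurableSet_range

/-! ### The invariant measure -/

/-- The uniform distribution on `C k`. -/
abbrev cutMeasure (k : ℕ) : Measure ↥(D.C k) := ProbabilityTheory.uniformOn Set.univ

instance (k : ℕ) : Nonempty ↥(D.C k) := ⟨⟨0, D.zero_mem k⟩⟩

theorem cutMeasure_singleton (k : ℕ) (c : ↥(D.C k)) :
    D.cutMeasure k {c} = ((D.C k).card : ℝ≥0∞)⁻¹ := by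
  rw [cutMeasure, ProbabilityTheory.uniformOn_univ, Measure.count_singleton]
  simp

/-- The product of the uniform distributions on `C n`, `C (n + 1)`, …. -/
abbrev tailMeasure (n : ℕ) : Measure ((k : Set.Ici n) → ↥(D.C k)) :=
  Measure.infinitePi fun k : Set.Ici n => D.cutMeasure k

/-- The sequence in `C n × C (n + 1) × ⋯` with the given first entry and remainder. -/
def cons (n : ℕ) (q : ↥(D.C n) × ((k : Set.Ici (n + 1)) → ↥(D.C k))) (k : Set.Ici n) :
    ↥(D.C k) :=
  if h : (k : ℕ) = n then ⟨q.1, by rw [h]; exact q.1.2⟩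
  else q.2 ⟨k, Nat.lt_of_le_of_ne k.2 (Ne.symm h)⟩

theorem cons_self (n : ℕ) (q : ↥(D.C n) × ((k : Set.Ici (n + 1)) → ↥(D.C k))) :
    D.cons n q ⟨n, Set.self_mem_Ici⟩ = q.1 := by
  simp [cons]

theorem cons_of_lt (n : ℕ) (q : ↥(D.C n) × ((k : Set.Ici (n + 1)) → ↥(D.C k))) {k : ℕ}
    (hk : n + 1 ≤ k) : D.cons n q ⟨k, (Nat.le_succ n).trans hk⟩ = q.2 ⟨k, hk⟩ := by
  rw [cons, dif_neg]
  dsimp only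
  omega

theorem measurable_cons (n : ℕ) : Measurable (D.cons n) := by
  refine measurable_pi_lambda _ fun k => ?_
  unfold cons
  split_ifs with h
  · exact (measurable_subtype_coe.comp measurable_fst).subtype_mk
  · exact (measurable_pi_apply _).comp measurable_snd

/-- The first entry and the remainder of a random sequence in `C n × C (n + 1) × ⋯` are independent. -/
theorem map_cons (n : ℕ) :
    ((D.cutMeasure n).prod (D.tailMeasure (n + 1))).map (D.cons n) = D.tailMeasure n := by
  refine Measure.eq_infinitePi _ fun s t ht => ?_
  rw [Measure.map_apply (D.measurable_cons n)
    (MeasurableSet.pi s.countable_toSet fun i _ => ht i)]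
  let next : Set.Ici (n + 1) → Set.Ici n := fun k => ⟨k, (Nat.le_succ n).trans k.2⟩
  have hnext : Function.Injective next := fun a b hab => by
    have : (a : ℕ) = b := congrArg (fun k : Set.Ici n => (k : ℕ)) hab
    exact Subtype.ext this
  let n₀ : Set.Ici n := ⟨n, Set.self_mem_Ici⟩
  classical
  have hpre : D.cons n ⁻¹' (s : Set (Set.Ici n)).pi t =
      (if n₀ ∈ s then t n₀ else Set.univ) ×ˢ
        ((s.preimage next hnext.injOn : Finset _) : Set (Set.Ici (n + 1))).pi
          fun k => t (next k) := by
    ext q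
    simp only [Set.mem_preimage, Set.mem_pi, Finset.mem_coe, Set.mem_prod, Finset.mem_preimage]
    constructor
    · intro h
      refine ⟨?_, fun k hk => ?_⟩
      · split_ifs with h0
        · have := h n₀ h0
          rwa [D.cons_self] at this
        · trivial
      · have := h (next k) hk
        rwa [D.cons_of_lt n q k.2] at this
    · rintro ⟨h1, h2⟩ ⟨k, hk⟩ hks
      rcases (show n ≤ k from hk).eq_or_lt with rfl | hlt
      · rw [if_pos hks] at h1
        rwa [D.cons_self]
      · rw [D.cons_of_lt n q hlt]
        exact h2 ⟨k, hlt⟩ hks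
  have htail := Measure.infinitePi_pi (fun k : Set.Ici (n + 1) => D.cutMeasure k)
    (s := s.preimage next hnext.injOn) (t := fun k => t (next k)) fun i _ => ht (next i)
  rw [hpre, Measure.prod_prod, htail]
  rw [← Finset.prod_filter_mul_prod_filter_not s (fun i => i = n₀)]
  congr 1
  · rw [Finset.filter_eq']
    split_ifs with h
    · simp
    · simp
  · rw [Finset.prod_preimage' next s hnext.injOn fun i => D.cutMeasure i (t i)]
    refine Finset.prod_congr ?_ fun _ _ => rfl
    ext ⟨k, hk⟩
    simp only [Finset.mem_filter, and_congr_right_iff, Set.mem_range]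
    intro _
    constructor
    · rintro ⟨j, hj⟩ h
      rw [h] at hj
      have h1 : (j : ℕ) = n := congrArg (fun k : Set.Ici n => (k : ℕ)) hj
      have h2 : n + 1 ≤ j := j.2
      omega
    · intro h
      have : k ≠ n := fun h' => h (Subtype.ext h')
      exact ⟨⟨k, Nat.lt_of_le_of_ne hk this.symm⟩, rfl⟩

theorem tailMeasure_apply (n : ℕ) {B : Set ((k : Set.Ici n) → ↥(D.C k))} (hB : MeasurableSet B) :
    D.tailMeasure n B =
      ∑ c : ↥(D.C n), ((D.C n).card : ℝ≥0∞)⁻¹ *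
        D.tailMeasure (n + 1) {t | D.cons n (c, t) ∈ B} := by
  rw [← D.map_cons, Measure.map_apply (D.measurable_cons n) hB,
    Measure.prod_apply (D.measurable_cons n hB), lintegral_fintype]
  refine Finset.sum_congr rfl fun c _ => ?_
  rw [cutMeasure_singleton, mul_comm]
  rfl

/-- The measure of a level of the `n`-th tower. -/
def levelMeasure (n : ℕ) : ℝ≥0∞ := (∏ k ∈ Finset.range n, ((D.C k).card : ℝ≥0∞))⁻¹

theorem levelMeasure_succ (n : ℕ) :
    D.levelMeasure (n + 1) = D.levelMeasure n * ((D.C n).card : ℝ≥0∞)⁻¹ := by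
  rw [levelMeasure, Finset.prod_range_succ, ENNReal.mul_inv, levelMeasure]
  · exact Or.inr (ENNReal.natCast_ne_top _)
  · exact Or.inl (ENNReal.prod_ne_top fun _ _ => ENNReal.natCast_ne_top _)

theorem levelMeasure_le (n : ℕ) : D.levelMeasure n ≤ (2⁻¹ : ℝ≥0∞) ^ n := by
  induction n with
  | zero => simp [levelMeasure]
  | succ n ih =>
    rw [levelMeasure_succ, pow_succ]
    refine mul_le_mul' ih (ENNReal.inv_le_inv.2 ?_)
    exact_mod_cast D.one_lt_card n

theorem tendsto_levelMeasure : Tendsto D.levelMeasure atTop (𝓝 0) :=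
  tendsto_of_tendsto_of_tendsto_of_le_of_le tendsto_const_nhds
    (ENNReal.tendsto_pow_atTop_nhds_zero_of_lt_one (by norm_num)) (fun _ => zero_le) D.levelMeasure_le

theorem towerMeasure_apply (n : ℕ) {B : Set (D.Tower n)} (hB : MeasurableSet B) :
    D.towerMeasure n B = D.levelMeasure n *
      ∑ f : ↥(D.F n), D.tailMeasure n (Prod.mk f ⁻¹' B) := by
  rw [towerMeasure, Measure.smul_apply, smul_eq_mul, Measure.prod_apply hB, lintegral_count,
    tsum_fintype]
  rfl

theorem towerMeasure_levels (n : ℕ) (S : Finset ℤ) (hS : S ⊆ D.F n) :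
    D.towerMeasure n {p | (p.1 : ℤ) ∈ S} = D.levelMeasure n * S.card := by
  have hm : MeasurableSet {p : D.Tower n | (p.1 : ℤ) ∈ S} :=
    (measurable_subtype_coe.comp measurable_fst) (MeasurableSet.of_discrete (s := (S : Set ℤ)))
  rw [D.towerMeasure_apply n hm]
  congr 1
  have : ∀ f : ↥(D.F n), D.tailMeasure n (Prod.mk f ⁻¹' {p : D.Tower n | (p.1 : ℤ) ∈ S}) =
      if (f : ℤ) ∈ S then 1 else 0 := by
    intro f
    by_cases h : (f : ℤ) ∈ S <;> simp [h]
  simp_rw [this]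
  rw [Finset.sum_coe_sort (D.F n) (fun f => if f ∈ S then (1 : ℝ≥0∞) else 0), Finset.sum_boole,
    Finset.filter_mem_eq_inter, Finset.inter_eq_right.2 hS]

theorem up_cons (n : ℕ) (f : ↥(D.F n)) (q : ↥(D.C n) × ((k : Set.Ici (n + 1)) → ↥(D.C k))) :
    D.up (Nat.le_succ n) (f, D.cons n q) =
      (⟨f + q.1, D.add_mem n _ f.2 _ q.1.2⟩, q.2) := by
  refine Prod.ext (Subtype.ext ?_) (funext fun k => D.cons_of_lt n q k.2)
  change D.pos _ (n + 1) = _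
  rw [D.pos_succ _ le_rfl, D.pos_self]
  exact congrArg (fun c : ↥(D.C n) => (f : ℤ) + c) (D.cons_self n q)

/-- The embedding `X_n → X_{n + 1}` is compatible with the measures: a level of `X_n` is divided into
`#C n` levels of `X_{n + 1}` of equal measure. -/
theorem towerMeasure_preimage_up_succ (n : ℕ) {A : Set (D.Tower (n + 1))} (hA : MeasurableSet A) :
    D.towerMeasure n (D.up (Nat.le_succ n) ⁻¹' A) =
      D.towerMeasure (n + 1) (A ∩ Set.range (D.up (Nat.le_succ n))) := by
  have hup := D.measurableEmbedding_up (Nat.le_succ n)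
  rw [D.towerMeasure_apply n (hup.measurable hA),
    D.towerMeasure_apply (n + 1) (hA.inter hup.measurableSet_range), levelMeasure_succ, mul_assoc]
  congr 1
  let g : ↥(D.F n) × ↥(D.C n) → ↥(D.F (n + 1)) := fun a =>
    ⟨a.1 + a.2, D.add_mem n _ a.1.2 _ a.2.2⟩
  have hg : Function.Injective g := by
    rintro ⟨f, c⟩ ⟨f', c'⟩ h
    have h : (f : ℤ) + c = f' + c' := congrArg Subtype.val h
    have hc : c = c' := by
      by_contra hne
      exact D.disjoint_translates n _ c.2 _ c'.2 (fun h' => hne (Subtype.ext h')) _ f.2 _ f'.2 h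
    subst hc
    rw [Subtype.ext (add_right_cancel h)]
  have hsum : ∑ a : ↥(D.F n) × ↥(D.C n),
      D.tailMeasure (n + 1) {t | D.up (Nat.le_succ n) (a.1, D.cons n (a.2, t)) ∈ A} =
      ∑ f : ↥(D.F (n + 1)), D.tailMeasure (n + 1)
        (Prod.mk f ⁻¹' (A ∩ Set.range (D.up (Nat.le_succ n)))) := by
    refine Fintype.sum_of_injective g hg _ _ (fun f hf => ?_) fun a => ?_
    · convert measure_empty (μ := D.tailMeasure (n + 1))
      refine Set.eq_empty_of_forall_notMem fun t ht => hf ?_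
      obtain ⟨p, hp⟩ := ht.2
      refine ⟨(p.1, p.2 ⟨n, Set.self_mem_Ici⟩), Subtype.ext ?_⟩
      have h1 : D.pos p (n + 1) = f := congrArg (fun p : D.Tower (n + 1) => (p.1 : ℤ)) hp
      rw [D.pos_succ p le_rfl, D.pos_self] at h1
      exact h1
    · congr 1
      ext t
      have h1 := D.up_cons n a.1 (a.2, t)
      simp only [Set.mem_ofPred_eq, Set.mem_preimage, Set.mem_inter_iff, h1]
      exact (and_iff_left ⟨_, h1⟩).symm
  rw [← hsum, Fintype.sum_prod_type, Finset.mul_sum]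
  refine Finset.sum_congr rfl fun f _ => ?_
  rw [D.tailMeasure_apply n (measurable_prodMk_left (hup.measurable hA)), Finset.mul_sum]
  rfl

theorem map_toSpace_apply_succ (n : ℕ) {A : Set D.Space} (hA : MeasurableSet A) :
    (D.towerMeasure n).map (D.toSpace n) A =
      (D.towerMeasure (n + 1)).map (D.toSpace (n + 1)) (A ∩ D.towerSet n) := by
  rw [Measure.map_apply (D.measurable_toSpace n) hA,
    Measure.map_apply (D.measurable_toSpace (n + 1)) (hA.inter (D.measurableSet_towerSet n))]
  have h1 : D.toSpace n ⁻¹' A = D.up (Nat.le_succ n) ⁻¹' (D.toSpace (n + 1) ⁻¹' A) := by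
    ext p
    rw [Set.mem_preimage, Set.mem_preimage, Set.mem_preimage, D.toSpace_up]
  have h2 : D.toSpace (n + 1) ⁻¹' D.towerSet n = Set.range (D.up (Nat.le_succ n)) := by
    ext p
    constructor
    · rintro ⟨q, hq⟩
      exact ⟨q, D.toSpace_injective _ (by rw [D.toSpace_up, hq])⟩
    · rintro ⟨q, rfl⟩
      exact ⟨q, (D.toSpace_up _ q).symm⟩
  rw [h1, D.towerMeasure_preimage_up_succ n (D.measurable_toSpace (n + 1) hA), Set.preimage_inter,
    h2]

theorem map_toSpace_apply {n m : ℕ} (h : n ≤ m) {A : Set D.Space} (hA : MeasurableSet A) :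
    (D.towerMeasure n).map (D.toSpace n) A =
      (D.towerMeasure m).map (D.toSpace m) (A ∩ D.towerSet n) := by
  induction m, h using Nat.le_induction with
  | base =>
    rw [Measure.map_apply (D.measurable_toSpace n) hA,
      Measure.map_apply (D.measurable_toSpace n) (hA.inter (D.measurableSet_towerSet n)),
      Set.preimage_inter, towerSet, Set.preimage_range, Set.inter_univ]
  | succ m h ih =>
    rw [ih, D.map_toSpace_apply_succ m (hA.inter (D.measurableSet_towerSet n)), Set.inter_assoc,
      Set.inter_eq_left.2 (D.towerSet_mono h)]

theorem fresh_eq (n : ℕ) : D.fresh n = D.toSpace n ⁻¹' disjointed D.towerSet n := by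
  ext p
  rw [disjointed_eq_inter_compl]
  simp [fresh, towerSet]

/-- The measure of `X`, although glued from its values on the differences of the towers, restricts to
the given measure on every tower. -/
theorem measure_inter_towerSet (n : ℕ) {A : Set D.Space} (hA : MeasurableSet A) :
    D.measure (A ∩ D.towerSet n) = (D.towerMeasure n).map (D.toSpace n) A := by
  have hA' := hA.inter (D.measurableSet_towerSet n)
  have hdisj : ∀ m, MeasurableSet (disjointed D.towerSet m) :=
    fun m => MeasurableSet.disjointed D.measurableSet_towerSet m
  have hterm : ∀ m, ((D.towerMeasure m).restrict (D.fresh m)).map (D.toSpace m)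
      (A ∩ D.towerSet n) = (D.towerMeasure n).map (D.toSpace n)
        (A ∩ D.towerSet n ∩ disjointed D.towerSet m) := by
    intro m
    rw [Measure.map_apply (D.measurable_toSpace m) hA',
      Measure.restrict_apply (D.measurable_toSpace m hA'), D.fresh_eq, ← Set.preimage_inter,
      ← Measure.map_apply (D.measurable_toSpace m) (hA'.inter (hdisj m))]
    rcases le_or_gt m n with h | h
    · rw [D.map_toSpace_apply h (hA'.inter (hdisj m)), Set.inter_assoc _ (disjointed _ _),
        Set.inter_eq_left.2 (disjointed_subset D.towerSet m)]
    · have : A ∩ D.towerSet n ∩ disjointed D.towerSet m = ∅ := by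
        refine Set.eq_empty_of_forall_notMem fun x hx => ?_
        rw [disjointed_eq_inter_compl] at hx
        exact Set.mem_iInter₂.1 hx.2.2 n h hx.1.2
      rw [this, measure_empty, measure_empty]
  rw [CFData.measure, Measure.sum_apply _ hA']
  simp_rw [hterm]
  rw [← measure_iUnion
    (fun i j hij => (disjoint_disjointed D.towerSet hij).mono Set.inter_subset_right
      Set.inter_subset_right) fun m => hA'.inter (hdisj m), ← Set.inter_iUnion,
    iUnion_disjointed, D.iUnion_towerSet, Set.inter_univ, D.map_toSpace_apply le_rfl hA]

theorem restrict_towerSet (n : ℕ) :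
    D.measure.restrict (D.towerSet n) = (D.towerMeasure n).map (D.toSpace n) := by
  ext A hA
  rw [Measure.restrict_apply hA, D.measure_inter_towerSet n hA]

theorem measure_image (n : ℕ) (B : Set (D.Tower n)) :
    D.measure (D.toSpace n '' B) = D.towerMeasure n B := by
  have h : D.measure.restrict (D.towerSet n) (D.toSpace n '' B) =
      (D.towerMeasure n).map (D.toSpace n) (D.toSpace n '' B) := by rw [D.restrict_towerSet]
  rw [Measure.restrict_apply' (D.measurableSet_towerSet n),
    (D.measurableEmbedding_toSpace n).map_apply,
    Set.preimage_image_eq _ (D.toSpace_injective n)] at h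
  rw [← h, Set.inter_eq_left.2 (show D.toSpace n '' B ⊆ D.towerSet n from
    Set.image_subset_range _ _)]

theorem measure_towerSet (n : ℕ) : D.measure (D.towerSet n) = D.levelMeasure n * D.h n := by
  have h := D.towerMeasure_levels n (D.F n) subset_rfl
  rw [towerSet, ← Set.image_univ, D.measure_image]
  convert h using 2
  · exact (Set.eq_univ_of_forall fun p => p.1.2).symm
  · simp [F]

/-! ### The transformation -/

/-- The cyclic shift of `F n`. -/
def cyclicShift (n : ℕ) (f : ↥(D.F n)) : ↥(D.F n) :=
  if h : (f : ℤ) + 1 ∈ D.F n then ⟨f + 1, h⟩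
  else ⟨0, Finset.mem_Ico.2 ⟨le_rfl,
    (Finset.mem_Ico.1 f.2).1.trans_lt (Finset.mem_Ico.1 f.2).2⟩⟩

theorem coe_cyclicShift (n : ℕ) (f : ↥(D.F n)) :
    (D.cyclicShift n f : ℤ) = if (f : ℤ) + 1 ∈ D.F n then (f : ℤ) + 1 else 0 := by
  unfold cyclicShift
  split_ifs <;> rfl

theorem cyclicShift_injective (n : ℕ) : Function.Injective (D.cyclicShift n) := by
  rintro ⟨f, hf⟩ ⟨g, hg⟩ h
  have h := congrArg Subtype.val h
  refine Subtype.ext ?_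
  rw [coe_cyclicShift, coe_cyclicShift] at h
  simp only [F, Finset.mem_Ico] at hf hg h ⊢
  split_ifs at h <;> omega

/-- The cyclic shift of the levels of the `n`-th tower. -/
def towerShift (n : ℕ) : D.Tower n → D.Tower n := Prod.map (D.cyclicShift n) id

theorem measurable_towerShift (n : ℕ) : Measurable (D.towerShift n) :=
  (measurable_of_countable _).prodMap measurable_id

theorem towerShift_injective (n : ℕ) : Function.Injective (D.towerShift n) :=
  (D.cyclicShift_injective n).prodMap Function.injective_id

theorem measurePreserving_towerShift (n : ℕ) :
    MeasurePreserving (D.towerShift n) (D.towerMeasure n) (D.towerMeasure n) := by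
  refine ⟨D.measurable_towerShift n, ?_⟩
  ext B hB
  rw [Measure.map_apply (D.measurable_towerShift n) hB, D.towerMeasure_apply n hB,
    D.towerMeasure_apply n (D.measurable_towerShift n hB)]
  congr 1
  exact Fintype.sum_bijective (D.cyclicShift n)
    (Finite.injective_iff_bijective.1 (D.cyclicShift_injective n)) _ _ fun f => rfl

theorem towerMeasure_image_towerShift (n : ℕ) (B : Set (D.Tower n)) :
    D.towerMeasure n (D.towerShift n '' B) = D.towerMeasure n B := by
  rw [← (D.measurePreserving_towerShift n).measure_preimage_emb
    ((D.measurable_towerShift n).measurableEmbedding (D.towerShift_injective n)),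
    Set.preimage_image_eq _ (D.towerShift_injective n)]

/-- The points of the `n`-th tower which are not in the top level. -/
def belowTop (n : ℕ) : Set (D.Tower n) := {p | (p.1 : ℤ) + 1 ∈ D.F n}

theorem measurableSet_belowTop (n : ℕ) : MeasurableSet (D.belowTop n) :=
  (measurable_subtype_coe.comp measurable_fst)
    (MeasurableSet.of_discrete (s := {f : ℤ | f + 1 ∈ D.F n}))

theorem transformation_of_belowTop {n : ℕ} {p : D.Tower n} (hp : p ∈ D.belowTop n) :
    D.transformation (D.toSpace n p) = D.toSpace n (D.towerShift n p) := by
  rw [D.transformation_toSpace p hp]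
  congr 1
  refine Prod.ext ?_ rfl
  exact (dif_pos hp).symm

theorem towerMeasure_compl_belowTop_le (n : ℕ) :
    D.towerMeasure n (D.belowTop n)ᶜ ≤ D.levelMeasure n := by
  have h0 : (0 : ℤ) < D.h n := by
    induction n with
    | zero => exact_mod_cast D.h_zero_pos
    | succ n ih =>
      have := Finset.mem_Ico.1 (D.add_mem n 0 (Finset.mem_Ico.2 ⟨le_rfl, ih⟩) 0 (D.zero_mem n))
      omega
  have h := D.towerMeasure_levels n {(D.h n : ℤ) - 1} (by
    simp only [F, Finset.singleton_subset_iff, Finset.mem_Ico]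
    omega)
  rw [Finset.card_singleton, Nat.cast_one, mul_one] at h
  rw [← h]
  refine measure_mono fun p hp => ?_
  have h1 := Finset.mem_Ico.1 p.1.2
  have h2 : ¬ (p.1 : ℤ) + 1 ∈ D.F n := hp
  simp only [F, Finset.mem_Ico] at h2
  rw [Set.mem_ofPred_eq, Finset.mem_singleton]
  omega

/-- The part of the domain of the `(C, F)`-transformation which is visible in the `n`-th tower. -/
def dom (n : ℕ) : Set D.Space := D.toSpace n '' D.belowTop n

theorem measurableSet_dom (n : ℕ) : MeasurableSet (D.dom n) :=
  (D.measurableEmbedding_toSpace n).measurableSet_image' (D.measurableSet_belowTop n)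

theorem dom_mono : Monotone D.dom := by
  refine monotone_nat_of_le_succ fun n => ?_
  rintro _ ⟨p, hp, rfl⟩
  refine ⟨D.up (Nat.le_succ n) p, ?_, D.toSpace_up _ p⟩
  have := D.add_mem n _ hp _ (p.2 ⟨n, Set.self_mem_Ici⟩).2
  change D.pos p (n + 1) + 1 ∈ D.F (n + 1)
  rw [D.pos_succ p le_rfl, D.pos_self, add_right_comm]
  exact this

/-- The points which the transformation leaves fixed for want of an image. -/
def exceptional : Set D.Space := (⋃ n, D.dom n)ᶜ

theorem measurableSet_exceptional : MeasurableSet D.exceptional :=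
  (MeasurableSet.iUnion D.measurableSet_dom).compl

theorem transformation_of_exceptional {x : D.Space} (hx : x ∈ D.exceptional) :
    D.transformation x = x := by
  refine dif_neg ?_
  rintro ⟨q, hq, hq1⟩
  exact hx (Set.mem_iUnion.2 ⟨q.1, q.2, hq1, hq⟩)

theorem measure_exceptional : D.measure D.exceptional = 0 := by
  have h : ∀ n, D.measure (D.exceptional ∩ D.towerSet n) = 0 := by
    intro n
    refine le_antisymm (ge_of_tendsto D.tendsto_levelMeasure ?_) zero_le
    filter_upwards [eventually_ge_atTop n] with m hm
    refine le_trans ?_ (D.towerMeasure_compl_belowTop_le m)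
    rw [← D.measure_image]
    refine measure_mono fun x hx => ?_
    obtain ⟨p, rfl⟩ := D.towerSet_mono hm hx.2
    exact ⟨p, fun hp => hx.1 (Set.mem_iUnion.2 ⟨m, p, hp, rfl⟩), rfl⟩
  rw [← Set.inter_univ D.exceptional, ← D.iUnion_towerSet, Set.inter_iUnion]
  exact measure_iUnion_null h

theorem preimage_transformation_inter_dom (n : ℕ) (A : Set D.Space) :
    D.transformation ⁻¹' A ∩ D.dom n =
      D.toSpace n '' (D.towerShift n ⁻¹' (D.toSpace n ⁻¹' A) ∩ D.belowTop n) := by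
  ext x
  constructor
  · rintro ⟨hx, p, hp, rfl⟩
    rw [Set.mem_preimage, D.transformation_of_belowTop hp] at hx
    exact ⟨p, ⟨hx, hp⟩, rfl⟩
  · rintro ⟨p, ⟨hx, hp⟩, rfl⟩
    refine ⟨?_, p, hp, rfl⟩
    rwa [Set.mem_preimage, D.transformation_of_belowTop hp]

theorem measurable_transformation : Measurable D.transformation := by
  intro A hA
  have : D.transformation ⁻¹' A =
      (A ∩ D.exceptional) ∪ ⋃ n, D.transformation ⁻¹' A ∩ D.dom n := by
    rw [← Set.inter_iUnion]
    ext x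
    by_cases hx : x ∈ ⋃ n, D.dom n
    · have : x ∉ D.exceptional := fun h => h hx
      simp only [Set.mem_union, Set.mem_inter_iff, hx, this, and_false, and_true, false_or]
    · have h : x ∈ D.exceptional := hx
      simp only [Set.mem_union, Set.mem_inter_iff, hx, h, and_false, and_true, or_false,
        Set.mem_preimage, D.transformation_of_exceptional h]
  rw [this]
  refine (hA.inter D.measurableSet_exceptional).union (MeasurableSet.iUnion fun n => ?_)
  rw [preimage_transformation_inter_dom]
  exact (D.measurableEmbedding_toSpace n).measurableSet_image'
    ((D.measurable_towerShift n (D.measurable_toSpace n hA)).inter (D.measurableSet_belowTop n))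

/-- The `(C, F)`-transformation preserves the measure: on a tower it agrees, outside of the top
level, with a cyclic shift, and the measure of the top level tends to zero. -/
theorem measurePreserving_transformation :
    MeasurePreserving D.transformation D.measure D.measure := by
  refine ⟨D.measurable_transformation, ?_⟩
  ext A hA
  rw [Measure.map_apply D.measurable_transformation hA]
  have h1 : Tendsto (fun n => D.measure (D.transformation ⁻¹' A ∩ D.dom n)) atTop
      (𝓝 (D.measure (D.transformation ⁻¹' A))) := by
    have h2 : D.measure (D.transformation ⁻¹' A) =
        D.measure (⋃ n, D.transformation ⁻¹' A ∩ D.dom n) := by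
      rw [← Set.inter_iUnion]
      refine (measure_inter_conull ?_).symm
      exact D.measure_exceptional
    rw [h2]
    exact tendsto_measure_iUnion_atTop fun a b hab => Set.inter_subset_inter_right _ (D.dom_mono hab)
  have h3 : Tendsto (fun n => D.measure (A ∩ D.towerSet n)) atTop (𝓝 (D.measure A)) := by
    have h := tendsto_measure_iUnion_atTop (μ := D.measure) (s := fun n => A ∩ D.towerSet n)
      fun a b hab => Set.inter_subset_inter_right _ (D.towerSet_mono hab)
    rwa [← Set.inter_iUnion, D.iUnion_towerSet, Set.inter_univ] at h
  have hshift : ∀ n, D.measure (A ∩ D.towerSet n) =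
      D.towerMeasure n (D.towerShift n ⁻¹' (D.toSpace n ⁻¹' A)) := by
    intro n
    rw [(D.measurePreserving_towerShift n).measure_preimage
      (D.measurable_toSpace n hA).nullMeasurableSet, D.measure_inter_towerSet n hA,
      Measure.map_apply (D.measurable_toSpace n) hA]
  refine le_antisymm (le_of_tendsto_of_tendsto' h1 h3 fun n => ?_)
    (le_of_tendsto_of_tendsto' h3 (by simpa using h1.add D.tendsto_levelMeasure) fun n => ?_)
  · rw [preimage_transformation_inter_dom, D.measure_image, hshift]
    exact measure_mono Set.inter_subset_left
  · rw [preimage_transformation_inter_dom, D.measure_image, hshift]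
    refine (measure_le_inter_add_sdiff _ _ (D.belowTop n)).trans ?_
    gcongr
    exact (measure_mono fun p hp => hp.2).trans (D.towerMeasure_compl_belowTop_le n)

/-- The set `S` need not be measurable, so that the inequality can be iterated. -/
theorem measure_image_transformation_le (S : Set D.Space) :
    D.measure (D.transformation '' S) ≤ D.measure S := by
  have hsub : D.transformation '' S ⊆
      D.exceptional ∪ ⋃ n, D.transformation '' (S ∩ D.dom n) := by
    rintro _ ⟨x, hx, rfl⟩
    by_cases h : x ∈ D.exceptional
    · rw [D.transformation_of_exceptional h]
      exact Or.inl h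
    · obtain ⟨n, hn⟩ := Set.mem_iUnion.1 (not_not.1 h)
      exact Or.inr (Set.mem_iUnion.2 ⟨n, x, ⟨hx, hn⟩, rfl⟩)
  refine (measure_mono hsub).trans ((measure_union_le _ _).trans ?_)
  rw [D.measure_exceptional, zero_add, Monotone.measure_iUnion fun a b hab =>
    Set.image_mono (Set.inter_subset_inter_right _ (D.dom_mono hab))]
  refine iSup_le fun n => ?_
  have h1 : S ∩ D.dom n = D.toSpace n '' (D.toSpace n ⁻¹' S ∩ D.belowTop n) := by
    rw [Set.image_preimage_inter, dom]
  have h2 : D.transformation '' (S ∩ D.dom n) =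
      D.toSpace n '' (D.towerShift n '' (D.toSpace n ⁻¹' S ∩ D.belowTop n)) := by
    rw [h1, Set.image_image, Set.image_image]
    exact Set.image_congr fun p hp => D.transformation_of_belowTop hp.2
  rw [h2, D.measure_image, D.towerMeasure_image_towerShift, ← D.measure_image, ← h1]
  exact measure_mono Set.inter_subset_left

theorem measure_image_iterate_le (k : ℕ) (S : Set D.Space) :
    D.measure (D.transformation^[k] '' S) ≤ D.measure S := by
  induction k with
  | zero => simp
  | succ k ih =>
    rw [Function.iterate_succ', Set.image_comp]
    exact (D.measure_image_transformation_le _).trans ih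

/-- Outside of the exceptional set, the `k`-th iterate of the transformation raises the position in
all high towers by `k`. -/
theorem iterate_mem_exceptional_or (k : ℕ) (x : D.Space) :
    D.transformation^[k] x ∈ D.exceptional ∨ ∃ N, ∀ n ≥ N, ∃ p q : D.Tower n,
      x = D.toSpace n p ∧ D.transformation^[k] x = D.toSpace n q ∧
        (q.1 : ℤ) = p.1 + k ∧ q.2 = p.2 := by
  induction k with
  | zero =>
    right
    obtain ⟨N, hN⟩ := Set.mem_iUnion.1 (D.iUnion_towerSet.symm ▸ Set.mem_univ x)
    refine ⟨N, fun n hn => ?_⟩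
    obtain ⟨p, rfl⟩ := D.towerSet_mono hn hN
    exact ⟨p, p, rfl, rfl, by simp, rfl⟩
  | succ k ih =>
    rw [Function.iterate_succ_apply']
    by_cases hx : D.transformation^[k] x ∈ D.exceptional
    · left
      rwa [D.transformation_of_exceptional hx]
    · right
      obtain ⟨N, hN⟩ := ih.resolve_left hx
      obtain ⟨N', hN'⟩ := Set.mem_iUnion.1 (not_not.1 hx)
      refine ⟨max N N', fun n hn => ?_⟩
      obtain ⟨p, q, hp, hq, hpos, htail⟩ := hN n (le_trans (le_max_left _ _) hn)
      obtain ⟨q', hq', hqq'⟩ := D.dom_mono (le_trans (le_max_right _ _) hn) hN'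
      obtain rfl : q' = q := D.toSpace_injective n (hqq'.trans hq)
      refine ⟨p, (⟨q'.1 + 1, hq'⟩, q'.2), hp, ?_, ?_, htail⟩
      · rw [hq]
        exact D.transformation_toSpace q' hq'
      · change (q'.1 : ℤ) + 1 = _
        rw [hpos]
        push_cast
        ring

/-! ### A criterion for mixing -/

/-- The positions of the points of `X_l` in the tower with number `l + j`. -/
def positions (l : ℕ) : ℕ → Finset ℤ
  | 0 => D.F l
  | j + 1 => Finset.image₂ (· + ·) (positions l j) (D.C (l + j))

theorem positions_subset (l j : ℕ) : D.positions l j ⊆ D.F (l + j) := by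
  induction j with
  | zero => exact subset_rfl
  | succ j ih =>
    intro x hx
    obtain ⟨f, hf, c, hc, rfl⟩ := Finset.mem_image₂.1 hx
    exact D.add_mem (l + j) f (ih hf) c hc

theorem pos_mem_positions {l : ℕ} (p : D.Tower l) (j : ℕ) :
    D.pos p (l + j) ∈ D.positions l j := by
  induction j with
  | zero => rw [add_zero, pos_self]; exact p.1.2
  | succ j ih =>
    rw [← add_assoc, D.pos_succ p (Nat.le_add_right l j)]
    exact Finset.mem_image₂_of_mem ih (p.2 ⟨l + j, Nat.le_add_right l j⟩).2

theorem mem_positions_of_mem_towerSet {l j : ℕ} {p : D.Tower (l + j)}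
    (h : D.toSpace (l + j) p ∈ D.towerSet l) : (p.1 : ℤ) ∈ D.positions l j := by
  obtain ⟨q, hq⟩ := h
  rw [← D.toSpace_up (Nat.le_add_right l j)] at hq
  obtain rfl := D.toSpace_injective _ hq
  exact D.pos_mem_positions q j

theorem card_positions_le (l j : ℕ) :
    (D.positions l j).card ≤ D.h l * ∏ k ∈ Finset.range (l + j), (D.C k).card := by
  induction j with
  | zero =>
    have : (D.positions l 0).card = D.h l := by simp [positions, F]
    rw [this]
    refine Nat.le_mul_of_pos_right _ (Finset.prod_pos fun k _ => ?_)
    exact (zero_lt_one.trans (D.one_lt_card k))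
  | succ j ih =>
    rw [← add_assoc, Finset.prod_range_succ, ← mul_assoc]
    exact (Finset.card_image₂_le _ _ _).trans (Nat.mul_le_mul_right _ ih)

theorem levelMeasure_mul_card_positions_le (l j : ℕ) :
    D.levelMeasure (l + j) * (D.positions l j).card ≤ D.h l := by
  have h : ((D.positions l j).card : ℝ≥0∞) ≤
      (∏ k ∈ Finset.range (l + j), ((D.C k).card : ℝ≥0∞)) * D.h l := by
    rw [mul_comm]
    exact_mod_cast D.card_positions_le l j
  rw [levelMeasure, mul_comm, ← div_eq_mul_inv]
  exact ENNReal.div_le_of_le_mul' h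

/-- The points of tower `l + j` whose position is in `positions l j` and remains there if it is
lowered by `k`. -/
def returnSet (l k j : ℕ) : Set D.Space :=
  D.toSpace (l + j) '' {p | (p.1 : ℤ) ∈
    (D.positions l j).filter fun x => x + -(k : ℤ) ∈ D.positions l j}

theorem returnSet_mono (l k : ℕ) : Monotone (D.returnSet l k) := by
  refine monotone_nat_of_le_succ fun j => ?_
  rintro _ ⟨p, hp, rfl⟩
  have hp := Finset.mem_filter.1 hp
  refine ⟨D.up (Nat.le_succ (l + j)) p, ?_, D.toSpace_up _ p⟩
  have hpos : (((D.up (Nat.le_succ (l + j)) p).1 : ↥(D.F (l + j + 1))) : ℤ) =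
      p.1 + p.2 ⟨l + j, Set.self_mem_Ici⟩ := by
    change D.pos p (l + j + 1) = _
    rw [D.pos_succ p le_rfl, D.pos_self]
  have hc := (p.2 ⟨l + j, Set.self_mem_Ici⟩).2
  refine Finset.mem_filter.2 ⟨?_, ?_⟩
  · rw [hpos]
    exact Finset.mem_image₂_of_mem hp.1 hc
  · rw [hpos, add_right_comm]
    exact Finset.mem_image₂_of_mem hp.2 hc

theorem measure_returnSet_le (l k j : ℕ) : D.measure (D.returnSet l k j) ≤
    D.h l * ENNReal.ofReal (autocorr (D.positions l j) k) := by
  rw [returnSet, D.measure_image, D.towerMeasure_levels _ _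
    ((Finset.filter_subset _ _).trans (D.positions_subset l j))]
  rcases (D.positions l j).eq_empty_or_nonempty with h | h
  · simp [h]
  have hc : (0 : ℝ) < (D.positions l j).card := by exact_mod_cast h.card_pos
  have h1 : (((D.positions l j).filter fun x => x + -(k : ℤ) ∈ D.positions l j).card : ℝ≥0∞) =
      (D.positions l j).card * ENNReal.ofReal (autocorr (D.positions l j) k) := by
    rw [← autocorr_neg, autocorr_eq_card, ← ENNReal.ofReal_natCast (D.positions l j).card,
      ← ENNReal.ofReal_mul hc.le, mul_div_cancel₀ _ hc.ne', ENNReal.ofReal_natCast]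
  rw [h1, ← mul_assoc]
  exact mul_le_mul_left (D.levelMeasure_mul_card_positions_le l j) _

theorem image_iterate_inter_subset (l k : ℕ) :
    D.transformation^[k] '' D.towerSet l ∩ D.towerSet l ⊆
      D.exceptional ∪ ⋃ j, D.returnSet l k j := by
  rintro _ ⟨⟨x, hx, rfl⟩, hy⟩
  rcases D.iterate_mem_exceptional_or k x with h | ⟨N, hN⟩
  · exact Or.inl h
  · obtain ⟨p, q, hp, hq, hpos, -⟩ := hN (l + N) (Nat.le_add_left _ _)
    rw [hp] at hx
    rw [hq] at hy
    refine Or.inr (Set.mem_iUnion.2 ⟨N, q, Finset.mem_filter.2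
      ⟨D.mem_positions_of_mem_towerSet hy, ?_⟩, hq.symm⟩)
    rw [hpos, add_neg_cancel_right]
    exact D.mem_positions_of_mem_towerSet hx

/-- A `(C, F)`-transformation is mixing if the autocorrelations of the positions of each `X_l` in
the towers tend to zero uniformly. -/
theorem isInfiniteMixing_of_autocorr
    (h : ∀ l, ∀ ε : ℝ, 0 < ε → ∃ k₀ : ℕ, ∀ k ≥ k₀, ∀ j,
      autocorr (D.positions l j) (k : ℕ) ≤ ε) :
    IsInfiniteMixing D.transformation D.measure := by
  refine ⟨D.measurePreserving_transformation, fun A B hA hB hAf hBf => ?_⟩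
  have hret : ∀ l k : ℕ, ∀ ε : ℝ, (∀ j, autocorr (D.positions l j) (k : ℕ) ≤ ε) →
      D.measure (D.transformation^[k] '' D.towerSet l ∩ D.towerSet l) ≤
        D.h l * ENNReal.ofReal ε := by
    intro l k ε hε
    refine (measure_mono (D.image_iterate_inter_subset l k)).trans
      ((measure_union_le _ _).trans ?_)
    rw [D.measure_exceptional, zero_add, (D.returnSet_mono l k).measure_iUnion]
    refine iSup_le fun j => (D.measure_returnSet_le l k j).trans ?_
    gcongr
    exact hε j
  have hdiff : ∀ S : Set D.Space, MeasurableSet S → D.measure S < ∞ →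
      Tendsto (fun l => D.measure (S \ D.towerSet l)) atTop (𝓝 0) := by
    intro S hS hSf
    have := tendsto_measure_iInter_atTop (μ := D.measure) (s := fun l => S \ D.towerSet l)
      (fun l => (hS.diff (D.measurableSet_towerSet l)).nullMeasurableSet)
      (fun a b hab => Set.sdiff_subset_sdiff_right (D.towerSet_mono hab))
      ⟨0, ((measure_mono Set.sdiff_subset).trans_lt hSf).ne⟩
    rwa [← Set.sdiff_iUnion, D.iUnion_towerSet, Set.sdiff_univ, measure_empty] at this
  rw [ENNReal.tendsto_nhds_zero]
  intro ε hε
  have hε3 : 0 < ε / 3 := ENNReal.div_pos hε.ne' (by norm_num)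
  obtain ⟨l, hl1, hl2⟩ := ((ENNReal.tendsto_nhds_zero.1 (hdiff A hA hAf) _ hε3).and
    (ENNReal.tendsto_nhds_zero.1 (hdiff B hB hBf) _ hε3)).exists
  obtain ⟨η, hη, hηε⟩ : ∃ η : ℝ, 0 < η ∧ D.h l * ENNReal.ofReal η ≤ ε / 3 := by
    have h1 : Tendsto (fun η : ℝ => (D.h l : ℝ≥0∞) * ENNReal.ofReal η) (𝓝[>] 0) (𝓝 0) := by
      have := ENNReal.Tendsto.const_mul (a := (D.h l : ℝ≥0∞))
        (ENNReal.tendsto_ofReal (tendsto_id (α := ℝ) (x := 𝓝 0)))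
        (Or.inr (ENNReal.natCast_ne_top _))
      simp only [id, ENNReal.ofReal_zero, mul_zero] at this
      exact this.mono_left nhdsWithin_le_nhds
    obtain ⟨η, h2, h3⟩ := ((ENNReal.tendsto_nhds_zero.1 h1 _ hε3).and
      self_mem_nhdsWithin).exists
    exact ⟨η, h3, h2⟩
  obtain ⟨k₀, hk₀⟩ := h l η hη
  filter_upwards [eventually_ge_atTop k₀] with k hk
  have hsub : D.transformation^[k] '' A ∩ B ⊆
      (D.transformation^[k] '' D.towerSet l ∩ D.towerSet l) ∪
        (D.transformation^[k] '' (A \ D.towerSet l) ∪ B \ D.towerSet l) := by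
    rintro _ ⟨⟨x, hx, rfl⟩, hy⟩
    by_cases h1 : x ∈ D.towerSet l
    · by_cases h2 : D.transformation^[k] x ∈ D.towerSet l
      · exact Or.inl ⟨⟨x, h1, rfl⟩, h2⟩
      · exact Or.inr (Or.inr ⟨hy, h2⟩)
    · exact Or.inr (Or.inl ⟨x, ⟨hx, h1⟩, rfl⟩)
  calc D.measure (D.transformation^[k] '' A ∩ B)
      ≤ D.measure (D.transformation^[k] '' D.towerSet l ∩ D.towerSet l) +
        (D.measure (D.transformation^[k] '' (A \ D.towerSet l)) +
          D.measure (B \ D.towerSet l)) :=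
        (measure_mono hsub).trans ((measure_union_le _ _).trans
          (by gcongr; exact measure_union_le _ _))
    _ ≤ ε / 3 + (ε / 3 + ε / 3) := by
        gcongr
        · exact (hret l k η (hk₀ k hk)).trans hηε
        · exact (D.measure_image_iterate_le k _).trans hl1
    _ = ε := by rw [← add_assoc, ENNReal.add_thirds]

end CFData

namespace HighStaircase

/-! ### High staircases -/

variable (h₀ : ℕ) (r z : ℕ → ℕ) (hh : 0 < h₀) (hr : ∀ n, 2 ≤ r n)

theorem stairPos_eq_cut (n i : ℕ) :
    stairPos (height h₀ r z n + z n) i = (cut h₀ r z n i : ℤ) := by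
  rw [cut_eq, stairPos, triangle]
  push_cast
  ring

theorem card_C (n : ℕ) : ((data h₀ r z hh hr).C n).card = r n := by
  refine (Finset.card_image_of_injOn fun i _ j _ hij => ?_).trans (Finset.card_range _)
  have hij' : cut h₀ r z n i = cut h₀ r z n j := by simpa using hij
  have hp := height_pos (z := z) hh hr n
  rcases lt_trichotomy i j with h | h | h
  · have := cut_add_height_le h₀ r z n h
    omega
  · exact h
  · have := cut_add_height_le h₀ r z n h
    omega

theorem positions_nonempty (l j : ℕ) : ((data h₀ r z hh hr).positions l j).Nonempty := by
  induction j with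
  | zero => exact ⟨0, Finset.mem_Ico.2 ⟨le_rfl, by exact_mod_cast height_pos hh hr l⟩⟩
  | succ j ih => exact Finset.image₂_nonempty_iff.2 ⟨ih, 0, (data h₀ r z hh hr).zero_mem _⟩

/-- The positions of `X_l` in the towers with numbers `l`, `l + 1`, …. -/
def staircasePositions (l : ℕ) : StaircasePositions where
  h j := height h₀ r z (l + j)
  r j := r (l + j)
  z j := z (l + j)
  E := (data h₀ r z hh hr).positions l
  two_le_r j := hr (l + j)
  h_succ _ := rfl
  nonempty j := positions_nonempty h₀ r z hh hr l j
  subset_Ico j := (data h₀ r z hh hr).positions_subset l j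
  E_succ j := by
    change Finset.image₂ (· + ·) _ ((Finset.range (r (l + j))).image fun i =>
      (cut h₀ r z (l + j) i : ℤ)) = _
    rw [Finset.image₂_image_right]
    simp_rw [stairPos_eq_cut]

/-- In infinite measure, the number of levels of the towers grows faster than the number of copies
of `X_0` in them. -/
theorem tendsto_prod_div_height
    (hinfinite : (data h₀ r z hh hr).measure Set.univ = ∞) :
    Tendsto (fun n => (∏ i ∈ Finset.range n, (r i : ℝ)) / height h₀ r z n) atTop (𝓝 0) := by
  set D := data h₀ r z hh hr
  have h1 : Tendsto (fun n => D.measure (D.towerSet n)) atTop (𝓝 ∞) := by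
    have := tendsto_measure_iUnion_atTop (μ := D.measure) D.towerSet_mono
    rwa [D.iUnion_towerSet, hinfinite] at this
  have h2 := (ENNReal.tendsto_toReal ENNReal.zero_ne_top).comp
    (ENNReal.inv_top ▸ tendsto_inv_iff.2 h1)
  refine h2.congr fun n => ?_
  have hC : ∀ i, (D.C i).card = r i := card_C h₀ r z hh hr
  simp only [Function.comp, D.measure_towerSet, CFData.levelMeasure, hC, ENNReal.toReal_inv,
    ENNReal.toReal_mul, ENNReal.toReal_prod, ENNReal.toReal_natCast, mul_inv, inv_inv]
  rfl

theorem tendsto_add_atTop (l : ℕ) : Tendsto (fun j => l + j) atTop atTop :=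
  tendsto_atTop_mono (fun j => Nat.le_add_left j l) tendsto_id

end HighStaircase

end

theorem theorem0p2 (h₀ : ℕ) (r z : ℕ → ℕ) (hh : 0 < h₀) (hr : ∀ n, 2 ≤ r n)
    (hr_tendsto : Tendsto r atTop atTop)
    (hgrowth : HighStaircase.RestrictedGrowth r)
    (hinfinite : (HighStaircase.data h₀ r z hh hr).measure Set.univ = ∞) :
    IsInfiniteMixing (HighStaircase.data h₀ r z hh hr).transformation
      (HighStaircase.data h₀ r z hh hr).measure := by
  have hthin := HighStaircase.tendsto_prod_div_height h₀ r z hh hr hinfinite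
  refine CFData.isInfiniteMixing_of_autocorr _ fun l ε hε => ?_
  have hl := HighStaircase.tendsto_add_atTop l
  refine (HighStaircase.staircasePositions h₀ r z hh hr l).exists_corr_le (hr_tendsto.comp hl)
    ?_ ?_ hε
  · have h1 : Tendsto (fun n => (r n : ℝ) ^ 2 / HighStaircase.height h₀ r z n) atTop (𝓝 0) := by
      have h2 := hgrowth.mul hthin
      rw [mul_zero] at h2
      refine h2.congr fun n => div_mul_div_cancel₀ ?_
      exact Finset.prod_ne_zero_iff.2 fun i _ => by
        have := hr i
        positivity
    exact h1.comp hl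
  · have h1 := (hthin.comp hl).const_mul (HighStaircase.height h₀ r z l : ℝ)
    rw [mul_zero] at h1
    refine squeeze_zero (fun j => by positivity) (fun j => ?_) h1
    have h2 := (HighStaircase.data h₀ r z hh hr).card_positions_le l j
    simp_rw [HighStaircase.card_C] at h2
    have h3 : (((HighStaircase.data h₀ r z hh hr).positions l j).card : ℝ) ≤
        HighStaircase.height h₀ r z l * ∏ i ∈ Finset.range (l + j), (r i : ℝ) := by
      exact_mod_cast h2
    rw [Function.comp, ← mul_div_assoc]
    exact div_le_div_of_nonneg_right h3 (Nat.cast_nonneg _)
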